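/- Let $(X,d,\mu)$ be a complete metric space with a Borel measure such that $0<\mu(B)<\infty$ for all balls $B$ and $\mu$ is doubling. Let $1\le p<\infty$ and assume that $X$ supports a $p$-Poincaré inequality, i.e. there are $C>0$ and $\lambda\ge1$ such that $$\frac1{\mu(B)}\int_B|u-u_B|\,d\mu\le C\operatorname{diam}(B)\Bigl(\frac1{\mu(\lambda B)}\int_{\lambda B}g^p\,d\mu\Bigr)^{1/p},\qquad u_B=\frac1{\mu(B)}\int_B u\,d\mu,$$ for all balls $B$, all $u$ in the Newtonian space $N^{1,p}(X)$ and all upper gradients $g$ of $u$. Let $\Omega\subsetneq X$ be a bounded nonempty connected open set. *Ends and prime ends.* A bounded connected set $E\subsetneq\Omega$ is acceptable if $\overline E\cap\partial\Omega\ne\emptyset$. A chain is a sequence $\{E_k\}_{k=1}^\infty$ of acceptable sets such that, for all $k$, $E_{k+1}\subset E_k$ and $\operatorname{dist}(\Omega\cap\partial E_{k+1},\Omega\cap\partial E_k)>0$, and such that the impression $\bigcap_k\overline{E_k}$ is contained in $\partial\Omega$. A chain $\{E_k\}$ divides a chain $\{F_k\}$ if for each $k$ there is $l$ with $E_l\subset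 F_k$; two chains are equivalent if they divide each other, and an end is an equivalence class of chains. Impressions and division pass to ends. A prime end is an end that is not divisible by any other end; the set of all prime ends is $\partial_P\Omega$. *$\mathrm{Mod}_p$-prime ends.* The $p$-modulus of a family $\Gamma$ of nonconstant rectifiable curves is $\mathrm{Mod}_p(\Gamma)=\inf_\rho\int_X\rho^p\,d\mu$, the infimum being over all nonnegative Borel functions $\rho$ with $\int_\gamma\rho\,ds\ge1$ for all $\gamma\in\Gamma$; and $\mathrm{Mod}_p(E,F,\Omega)$ is the $p$-modulus of the family of nonconstant rectifiable curves in $\Omega$ starting in $E$ and ending in $F$. A $\mathrm{Mod}_p$-end is an end represented by a chain $\{E_k\}$ with $\lim_{k\to\infty}\mathrm{Mod}_p(E_k,K,\Omega)=0$ for every compact $K\subset\Omega$. A $\mathrm{Mod}_p$-prime end is a $\mathrm{Mod}_p$-end that is not divisible by any other $\mathrm{Mod}_p$-end. *Further notions.* A point $x\in\partial\Omega$ is accessible if there is a (continuous, possibly nonrectifiable) curve $\gamma:[0,1]\to X$ with $\gamma(1)=x$ and $\gamma([0,1))\subset\Omega$. The set $\Omega$ is finitely connected at the boundary if for every $x\in\partial\Omega$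 and every $r>0$ there is an open set $G\subset X$ with $x\in G\subset B(x,r)$ such that $G\cap\Omega$ has only finitely many components. For $x\in X$, $Q(x)$ is the set of all $q>0$ for which there are constants $C_q,R_q>0$ such that $\mu(B(x,r))/\mu(B(x,R))\le C_q(r/R)^q$ for all $0<r\le R\le R_q$. **Theorem.** Assume that $\Omega$ is finitely connected at the boundary. Then the impression of every prime end is a singleton. Moreover, for every $x\in\partial\Omega$ there is a prime end with impression $\{x\}$, and $x$ is accessible. If furthermore $p\in Q(x)\ne(0,1]$ for every $x\in\partial\Omega$, then $\partial_P\Omega$ is equal to the set of all $\mathrm{Mod}_p$-prime ends of $\Omega$. -/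

import Mathlib

open Set Metric MeasureTheory Filter Topology
open scoped ENNReal

namespace PrimeEnds

/-! ### Rectifiable curves, upper gradients, modulus, Poincaré inequality -/

section Curves

variable {X : Type*} [MetricSpace X]

/-- A nonconstant rectifiable curve `γ : [0, l] → X`, parameterized by arc length. Only the values
of `toFun` on `[0, l]` are ever used. -/
structure RectCurve (X : Type*) [MetricSpace X] where
  /-- the length of the curve -/
  length : ℝ
  length_pos : 0 < length
  toFun : ℝ → X
  unitSpeed : HasUnitSpeedOn toFun (Icc 0 length)

/-- The starting point of a curve. -/
def RectCurve.source (γ : RectCurve X) : X := γ.toFun 0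

/-- The end point of a curve. -/
def RectCurve.target (γ : RectCurve X) : X := γ.toFun γ.length

/-- The arc length integral `∫_γ g ds` of a nonnegative function. -/
noncomputable def RectCurve.integral (γ : RectCurve X) (g : X → ℝ≥0∞) : ℝ≥0∞ :=
  ∫⁻ t in Icc 0 γ.length, g (γ.toFun t)

/-- The family `Γ(E, F, U)` of all nonconstant rectifiable curves in `U` starting in `E` and ending
in `F`. -/
def curveFamily (E F U : Set X) : Set (RectCurve X) :=
  {γ | (∀ t ∈ Icc 0 γ.length, γ.toFun t ∈ U) ∧ γ.source ∈ E ∧ γ.target ∈ F}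

variable [MeasurableSpace X]

/-- The `p`-modulus of a family of nonconstant rectifiable curves. -/
noncomputable def modulus (μ : Measure X) (p : ℝ) (Γ : Set (RectCurve X)) : ℝ≥0∞ :=
  ⨅ (ρ : X → ℝ≥0∞) (_ : Measurable ρ ∧ ∀ γ ∈ Γ, 1 ≤ γ.integral ρ), ∫⁻ x, ρ x ^ p ∂μ

/-- A nonnegative Borel function `g` is an upper gradient of the extended real-valued function `u`:
for every nonconstant rectifiable curve `γ` with end points `x` and `y`,
`|u x - u y| ≤ ∫_γ g ds` if both `u x` and `u y` are finite, and `∫_γ g ds = ∞` otherwise. -/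
def IsUpperGradient (g : X → ℝ≥0∞) (u : X → EReal) : Prop :=
  Measurable g ∧ ∀ γ : RectCurve X,
    ((u γ.source ≠ ⊤ ∧ u γ.source ≠ ⊥ ∧ u γ.target ≠ ⊤ ∧ u γ.target ≠ ⊥) →
      (u γ.source - u γ.target).abs ≤ γ.integral g) ∧
    (¬ (u γ.source ≠ ⊤ ∧ u γ.source ≠ ⊥ ∧ u γ.target ≠ ⊤ ∧ u γ.target ≠ ⊥) →
      γ.integral g = ⊤)

/-- The Newtonian (semi)norm `‖u‖_{N^{1,p}(X)}`. -/
noncomputable def newtonianNorm (μ : Measure X) (p : ℝ) (u : X → EReal) : ℝ≥0∞ :=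
  (∫⁻ x, (u x).abs ^ p ∂μ +
    ⨅ (g : X → ℝ≥0∞) (_ : IsUpperGradient g u), ∫⁻ x, g x ^ p ∂μ) ^ (1 / p)

/-- `u` (an everywhere defined, `μ`-measurable function) belongs to the Newtonian space
`N^{1,p}(X)`. -/
def MemNewtonian (μ : Measure X) (p : ℝ) (u : X → EReal) : Prop :=
  AEMeasurable u μ ∧ newtonianNorm μ p u < ⊤

/-- `X` supports a `p`-Poincaré inequality: there are `C > 0` and `lam ≥ 1` such that
`⨍_B |u - u_B| dμ ≤ C (diam B) (⨍_{lam B} g ^ p dμ) ^ (1 / p)` for all balls `B`, all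
`u ∈ N^{1,p}(X)` and all upper gradients `g` of `u`. (Functions in `N^{1,p}(X)` are finite almost
everywhere, so `toReal` is harmless under the integral sign.) -/
def SupportsPoincare (μ : Measure X) (p : ℝ) : Prop :=
  ∃ C lam : ℝ, 0 < C ∧ 1 ≤ lam ∧
    ∀ (x : X) (r : ℝ), 0 < r →
      ∀ u : X → EReal, MemNewtonian μ p u →
        ∀ g : X → ℝ≥0∞, IsUpperGradient g u →
          ⨍⁻ y in ball x r,
              ENNReal.ofReal |(u y).toReal - ⨍ z in ball x r, (u z).toReal ∂μ| ∂μ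
            ≤ ENNReal.ofReal (C * diam (ball x r)) *
                (⨍⁻ y in ball x (lam * r), g y ^ p ∂μ) ^ (1 / p)

/-- `μ` is a doubling measure. -/
def IsDoubling (μ : Measure X) : Prop :=
  ∃ C : ℝ, 0 < C ∧ ∀ (x : X) (r : ℝ), 0 < r →
    μ (ball x (2 * r)) ≤ ENNReal.ofReal C * μ (ball x r)

/-- The pointwise dimension set `Q(x)`: all `q > 0` for which there are `C, R₀ > 0` with
`μ(B(x,r)) / μ(B(x,R)) ≤ C (r / R) ^ q` whenever `0 < r ≤ R ≤ R₀`. -/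
def dimensionSet (μ : Measure X) (x : X) : Set ℝ :=
  {q | 0 < q ∧ ∃ C R₀ : ℝ, 0 < C ∧ 0 < R₀ ∧ ∀ r R : ℝ, 0 < r → r ≤ R → R ≤ R₀ →
    μ.real (ball x r) / μ.real (ball x R) ≤ C * (r / R) ^ q}

end Curves

/-! ### Chains, ends and prime ends -/

section Ends

variable {X : Type*} [MetricSpace X]

/-- `E` is an acceptable subset of `Ω`. -/
structure IsAcceptable (Ω E : Set X) : Prop where
  isBounded : Bornology.IsBounded E
  isConnected : IsConnected E
  ssubset : E ⊂ Ω
  meets_boundary : (closure E ∩ frontier Ω).Nonempty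

/-- A chain of acceptable subsets of `Ω`. The field `separated` says that the distance between
`Ω ∩ ∂E_{k+1}` and `Ω ∩ ∂E_k` is positive. -/
structure Chain (Ω : Set X) where
  sets : ℕ → Set X
  acceptable : ∀ k, IsAcceptable Ω (sets k)
  subset : ∀ k, sets (k + 1) ⊆ sets k
  separated : ∀ k, ∃ δ : ℝ, 0 < δ ∧
    ∀ x ∈ Ω ∩ frontier (sets (k + 1)), ∀ y ∈ Ω ∩ frontier (sets k), δ ≤ dist x y
  impression_subset : ⋂ k, closure (sets k) ⊆ frontier Ω

variable {Ω : Set X}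

/-- The impression of a chain. -/
def Chain.impression (c : Chain Ω) : Set X := ⋂ k, closure (c.sets k)

/-- The chain `c` divides the chain `d`. -/
def Chain.Divides (c d : Chain Ω) : Prop := ∀ k, ∃ l, c.sets l ⊆ d.sets k

theorem Chain.Divides.refl (c : Chain Ω) : c.Divides c := fun k => ⟨k, Subset.rfl⟩

theorem Chain.Divides.trans {c d e : Chain Ω} (h₁ : c.Divides d) (h₂ : d.Divides e) :
    c.Divides e := fun k => by
  obtain ⟨l, hl⟩ := h₂ k
  obtain ⟨m, hm⟩ := h₁ l
  exact ⟨m, hm.trans hl⟩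

theorem Chain.Divides.impression_subset {c d : Chain Ω} (h : c.Divides d) :
    c.impression ⊆ d.impression := by
  refine subset_iInter fun k => ?_
  obtain ⟨l, hl⟩ := h k
  exact (iInter_subset _ l).trans (closure_mono hl)

/-- Two chains are equivalent if they divide each other. -/
def Chain.Equivalent (c d : Chain Ω) : Prop := c.Divides d ∧ d.Divides c

/-- Equivalence of chains as a setoid. -/
def chainSetoid (Ω : Set X) : Setoid (Chain Ω) where
  r := Chain.Equivalent
  iseqv :=
    { refl := fun c => ⟨Chain.Divides.refl c, Chain.Divides.refl c⟩
      symm := fun h => ⟨h.2, h.1⟩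
      trans := fun h₁ h₂ => ⟨h₁.1.trans h₂.1, h₂.2.trans h₁.2⟩ }

/-- The ends of `Ω`, i.e. the equivalence classes of chains. As a type this is the end boundary. -/
def BoundaryEnd (Ω : Set X) : Type _ := Quotient (chainSetoid Ω)

/-- The end represented by a chain. -/
def Chain.toEnd (c : Chain Ω) : BoundaryEnd Ω := Quotient.mk (chainSetoid Ω) c

/-- The impression of an end is the impression of any representing chain. -/
def BoundaryEnd.impression (e : BoundaryEnd Ω) : Set X :=
  Quotient.lift Chain.impression
    (fun (c d : Chain Ω) (h : c.Equivalent d) => Subset.antisymm h.1.impression_subset h.2.impression_subset) e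

/-- Division of ends is division of any representing chains. -/
def BoundaryEnd.Divides (e f : BoundaryEnd Ω) : Prop :=
  Quotient.lift₂ Chain.Divides
    (fun (a b a' b' : Chain Ω) (h₁ : a.Equivalent a') (h₂ : b.Equivalent b') => propext
      ⟨fun h => h₁.2.trans (h.trans h₂.1), fun h => h₁.1.trans (h.trans h₂.2)⟩) e f

/-- A prime end is an end that is not divisible by any other end. -/
def BoundaryEnd.IsPrime (e : BoundaryEnd Ω) : Prop := ∀ f : BoundaryEnd Ω, f.Divides e → f = e

/-- The prime end boundary of `Ω`. -/
def primeEndBoundary (Ω : Set X) : Set (BoundaryEnd Ω) := {e | e.IsPrime}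

variable [MeasurableSpace X]

/-- A chain is a `Mod_p`-chain if `Mod_p(E_k, K, Ω) → 0` for every compact `K ⊆ Ω`. -/
def Chain.IsMod (μ : Measure X) (p : ℝ) (c : Chain Ω) : Prop :=
  ∀ K : Set X, IsCompact K → K ⊆ Ω →
    Tendsto (fun k => modulus μ p (curveFamily (c.sets k) K Ω)) atTop (𝓝 0)

/-- A `Mod_p`-end is an end represented by some `Mod_p`-chain. -/
def BoundaryEnd.IsMod (μ : Measure X) (p : ℝ) (e : BoundaryEnd Ω) : Prop :=
  ∃ c : Chain Ω, c.toEnd = e ∧ c.IsMod μ p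

/-- A `Mod_p`-prime end is a `Mod_p`-end that is not divisible by any other `Mod_p`-end. -/
def BoundaryEnd.IsModPrime (μ : Measure X) (p : ℝ) (e : BoundaryEnd Ω) : Prop :=
  e.IsMod μ p ∧ ∀ f : BoundaryEnd Ω, f.IsMod μ p → f.Divides e → f = e

/-- The `Mod_p`-prime end boundary of `Ω`. -/
def modPrimeEndBoundary (μ : Measure X) (p : ℝ) (Ω : Set X) : Set (BoundaryEnd Ω) :=
  {e | e.IsModPrime μ p}

end Ends

/-! ### Accessibility and finite connectedness at the boundary -/

section Boundary

variable {X : Type*} [MetricSpace X]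

/-- `x` is an accessible boundary point of `Ω`. -/
def IsAccessible (Ω : Set X) (x : X) : Prop :=
  x ∈ frontier Ω ∧ ∃ γ : ℝ → X, ContinuousOn γ (Icc 0 1) ∧ γ 1 = x ∧ ∀ t ∈ Ico (0 : ℝ) 1, γ t ∈ Ω

/-- `Ω` is finitely connected at `x`: arbitrarily small open neighborhoods `G` of `x` are such that
`G ∩ Ω` has only finitely many connected components. -/
def FinitelyConnectedAt (Ω : Set X) (x : X) : Prop :=
  ∀ r : ℝ, 0 < r → ∃ G : Set X, IsOpen G ∧ x ∈ G ∧ G ⊆ ball x r ∧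
    {A : Set X | ∃ y ∈ G ∩ Ω, A = connectedComponentIn (G ∩ Ω) y}.Finite

/-- `Ω` is finitely connected at the boundary. -/
def FinitelyConnectedAtBoundary (Ω : Set X) : Prop := ∀ x ∈ frontier Ω, FinitelyConnectedAt Ω x

end Boundary

end PrimeEnds

/-! Doubling and completeness make `X` proper. Together with the Poincaré inequality they also make
it locally path connected. Test functions that are `1`-Lipschitz at some scale `ε`, applied to a
truncated `ε`-chain distance, show that any two points `x`, `y` are joined by `ε`-chains of length
at most `L * dist x y`, with `L` independent of `ε`. Letting `ε → 0` gives curves. Components of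
open sets are therefore open, and connected open sets are path connected.

Let `x` be a boundary point. An ultrafilter on `Ω` converging to `x` contains one of the finitely
many components of `G ∩ Ω`, hence one component of each `B(x,r) ∩ Ω`. For radii decreasing to `0`
these components are nested, and their boundaries in `Ω` lie on distinct spheres, so they form a
chain with impression `{x}` (`FinitelyConnectedAt.exists_chain`). Joining its sets by paths makes
`x` accessible.

A chain with one-point impression represents a prime end: a small connected set meeting `E_{k+1}`
cannot leave `E_k` (`Chain.exists_subset_of_meets`), so division is reversible. Conversely, if the
ultrafilter contains every set of a given chain, the new chain divides that chain
(`FinitelyConnectedAtBoundary.exists_divides`). Hence every prime end has a singleton impression.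

If `p ∈ Q(x) ≠ (0,1]`, a density spread over dyadic annuli shows that curves from tiny balls about
`x` to a fixed distance have small modulus. Chains with singleton impression are then
`Mod_p`-chains, and the two notions of prime end coincide. -/

namespace PrimeEnds

/-! ### Doubling and completeness imply properness -/

section Proper

variable {X : Type*} [MetricSpace X] [MeasurableSpace X]

/-- Iterating the doubling condition. -/
theorem IsDoubling.exists_iterate {μ : Measure X} (h : IsDoubling μ) :
    ∃ C : ℝ, 1 ≤ C ∧ ∀ (n : ℕ) (x : X) (r : ℝ), 0 < r →
      μ (ball x (2 ^ n * r)) ≤ ENNReal.ofReal (C ^ n) * μ (ball x r) := by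
  obtain ⟨C, -, hC⟩ := h
  refine ⟨max C 1, le_max_right _ _, fun n => ?_⟩
  have hC1 : 0 ≤ max C 1 := zero_le_one.trans (le_max_right _ _)
  induction n with
  | zero => intro x r _; simp
  | succ n ih =>
    intro x r hr
    have h1 := hC x (2 ^ n * r) (by positivity)
    calc μ (ball x (2 ^ (n + 1) * r)) = μ (ball x (2 * (2 ^ n * r))) := by ring_nf
      _ ≤ ENNReal.ofReal (max C 1) * μ (ball x (2 ^ n * r)) :=
        h1.trans (by gcongr; exact le_max_left _ _)
      _ ≤ ENNReal.ofReal (max C 1) * (ENNReal.ofReal (max C 1 ^ n) * μ (ball x r)) := by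
        gcongr; exact ih x r hr
      _ = ENNReal.ofReal (max C 1 ^ (n + 1)) * μ (ball x r) := by
        rw [← mul_assoc, ← ENNReal.ofReal_mul hC1, pow_succ']

/-- A complete metric space carrying a doubling measure is proper. -/
theorem properSpace_of_isDoubling [CompleteSpace X] [BorelSpace X] {μ : Measure X}
    (hμ : ∀ (x : X) (r : ℝ), 0 < r → 0 < μ (ball x r) ∧ μ (ball x r) < ⊤)
    (h : IsDoubling μ) : ProperSpace X := by
  obtain ⟨C, hC1, hC⟩ := h.exists_iterate
  refine ⟨fun x R => isCompact_iff_totallyBounded_isComplete.2 ⟨?_, isClosed_closedBall.isComplete⟩⟩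
  rw [Metric.totallyBounded_iff]
  intro ε hε
  by_contra hcon
  push Not at hcon
  -- Failure of total boundedness yields greedily an infinite `ε`-separated sequence. The balls of
  -- radius `ε / 2` about it are disjoint, lie in one ball of finite measure, and have measure
  -- bounded below by doubling.
  obtain ⟨f, hf, hfr⟩ := exists_seq_of_forall_finset_exists (fun y => y ∈ closedBall x R)
    (fun y z => ε ≤ dist z y) (fun s _ => by
      have := hcon s s.finite_toSet
      rw [not_subset] at this
      obtain ⟨y, hy, hys⟩ := this
      refine ⟨y, hy, fun z hz => ?_⟩
      by_contra hlt
      exact hys (mem_iUnion₂.2 ⟨z, hz, mem_ball.2 (not_le.1 hlt)⟩))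
  have hR : 0 ≤ R := dist_nonneg.trans (mem_closedBall.1 (hf 0))
  obtain ⟨n, hn⟩ := pow_unbounded_of_one_lt ((2 * R + 1) / (ε / 2)) one_lt_two
  rw [div_lt_iff₀ (by positivity)] at hn
  have hsub : ∀ i, ball x (R + 1) ⊆ ball (f i) (2 ^ n * (ε / 2)) := fun i =>
    ball_subset_ball' (by
      have := mem_closedBall.1 (hf i)
      rw [dist_comm] at this
      linarith)
  have hlow : ∀ i, μ (ball x (R + 1)) / ENNReal.ofReal (C ^ n) ≤ μ (ball (f i) (ε / 2)) :=
    fun i => ENNReal.div_le_of_le_mul' ((measure_mono (hsub i)).trans (hC n _ _ (by positivity)))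
  have hpos : 0 < μ (ball x (R + 1)) / ENNReal.ofReal (C ^ n) :=
    ENNReal.div_pos (hμ x _ (by positivity)).1.ne' ENNReal.ofReal_ne_top
  have hdisj : Pairwise (Function.onFun Disjoint fun i => ball (f i) (ε / 2)) := by
    intro i j hij
    refine ball_disjoint_ball ?_
    rcases lt_or_gt_of_ne hij with hlt | hlt
    · have := hfr i j hlt
      rw [dist_comm] at this
      linarith
    · have := hfr j i hlt
      linarith
  have hfin := Measure.finite_const_le_meas_of_disjoint_iUnion μ hpos
    (fun i => measurableSet_ball (x := f i) (ε := ε / 2)) hdisj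
    ((measure_mono (iUnion_subset fun i => ball_subset_ball' (ε₂ := R + ε / 2) (by
      have := mem_closedBall.1 (hf i)
      linarith))).trans_lt (hμ x (R + ε / 2) (by positivity)).2).ne
  exact infinite_univ (hfin.subset fun i _ => hlow i)

end Proper

/-! ### Curve integrals and upper gradients of coarsely Lipschitz functions -/

section CurveIntegrals

variable {X : Type*} [MetricSpace X]

/-- Distance is bounded by variation, which arc length parametrization makes equal to the parameter
difference. -/
theorem RectCurve.lipschitzOnWith (γ : RectCurve X) :
    LipschitzOnWith 1 γ.toFun (Icc 0 γ.length) := by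
  have key : ∀ s ∈ Icc 0 γ.length, ∀ t ∈ Icc 0 γ.length, s ≤ t →
      dist (γ.toFun s) (γ.toFun t) ≤ dist s t := by
    intro s hs t ht hst
    have h1 := γ.unitSpeed hs ht
    have h2 : edist (γ.toFun s) (γ.toFun t) ≤ eVariationOn γ.toFun (Icc 0 γ.length ∩ Icc s t) :=
      eVariationOn.edist_le _ ⟨hs, left_mem_Icc.2 hst⟩ ⟨ht, right_mem_Icc.2 hst⟩
    rw [h1, edist_dist] at h2
    rw [dist_comm s t, Real.dist_eq, abs_of_nonneg (sub_nonneg.2 hst)]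
    simpa using (ENNReal.ofReal_le_ofReal_iff (by simpa using hst)).1 h2
  refine LipschitzOnWith.of_dist_le_mul fun s hs t ht => ?_
  rw [NNReal.coe_one, one_mul]
  rcases le_total s t with h | h
  · exact key s hs t ht h
  · rw [dist_comm, dist_comm s]; exact key t ht s hs h

theorem continuous_of_scale {u : X → ℝ} {ε : ℝ} (hε : 0 < ε)
    (hu : ∀ x y, dist x y < ε → |u x - u y| ≤ dist x y) : Continuous u := by
  refine Metric.continuous_iff.2 fun x δ hδ => ⟨min ε δ, lt_min hε hδ, fun y hy => ?_⟩
  exact (hu y x (hy.trans_le (min_le_left _ _))).trans_lt (hy.trans_le (min_le_right _ _))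

theorem integrableOn_ball_of_bounded [MeasurableSpace X] {μ : Measure X}
    (hμ : ∀ (x : X) (r : ℝ), 0 < r → 0 < μ (ball x r) ∧ μ (ball x r) < ⊤)
    {u : X → ℝ} {M : ℝ} (hum : Measurable u) (hu : ∀ x, |u x| ≤ M) {x : X} {r : ℝ} (hr : 0 < r) :
    IntegrableOn u (ball x r) μ :=
  Measure.integrableOn_of_bounded (hμ x r hr).2.ne hum.aestronglyMeasurable
    (M := M) (ae_of_all _ hu)

variable [MeasurableSpace X] [BorelSpace X]

theorem RectCurve.aemeasurable (γ : RectCurve X) :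
    AEMeasurable γ.toFun (volume.restrict (Icc 0 γ.length)) :=
  γ.lipschitzOnWith.continuousOn.aemeasurable measurableSet_Icc

/-- A `1`-Lipschitz function along a curve spends at least as much time in a set `S` of
intermediate values as the measure of `S`. -/
theorem RectCurve.volume_le_integral_indicator (γ : RectCurve X) {h : X → ℝ} {A : Set X}
    {S : Set ℝ} (hh : LipschitzOnWith 1 (fun t => h (γ.toFun t)) (Icc 0 γ.length))
    (hA : MeasurableSet A) (hS : S ⊆ uIcc (h γ.source) (h γ.target)) (hSA : h ⁻¹' S ⊆ A) :
    volume S ≤ γ.integral (A.indicator 1) := by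
  have himg : S ⊆ (fun t => h (γ.toFun t)) '' (Icc 0 γ.length ∩ γ.toFun ⁻¹' A) := by
    intro s hs
    have hiv := intermediate_value_uIcc (f := fun t => h (γ.toFun t)) (a := 0) (b := γ.length)
      (by rw [uIcc_of_le γ.length_pos.le]; exact hh.continuousOn)
    obtain ⟨t, ht, rfl⟩ := hiv (hS hs)
    rw [uIcc_of_le γ.length_pos.le] at ht
    exact ⟨t, ⟨ht, hSA hs⟩, rfl⟩
  -- On the line, Lebesgue measure is one-dimensional Hausdorff measure, which a `1`-Lipschitz map
  -- does not increase.
  have hvol : volume S ≤ volume (Icc 0 γ.length ∩ γ.toFun ⁻¹' A) := by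
    refine (measure_mono himg).trans ?_
    have := (hh.mono (inter_subset_left (t := γ.toFun ⁻¹' A))).hausdorffMeasure_image_le
      (d := 1) zero_le_one
    simpa [hausdorffMeasure_real] using this
  have hnull : NullMeasurableSet (γ.toFun ⁻¹' A) (volume.restrict (Icc 0 γ.length)) :=
    γ.aemeasurable.nullMeasurable hA
  have hint : γ.integral (A.indicator 1) = volume (Icc 0 γ.length ∩ γ.toFun ⁻¹' A) := by
    have : (fun t => A.indicator (1 : X → ℝ≥0∞) (γ.toFun t))
        = (γ.toFun ⁻¹' A).indicator (fun _ => 1) := by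
      rfl
    rw [RectCurve.integral, this, lintegral_indicator_const₀ hnull, one_mul,
      Measure.restrict_apply₀ hnull, inter_comm]
  rw [hint]; exact hvol

/-- A function on an interval which is `1`-Lipschitz at a fixed positive scale is `1`-Lipschitz. -/
theorem lipschitzOnWith_of_scale {v : ℝ → ℝ} {a b ε : ℝ} (hε : 0 < ε)
    (hv : ∀ s ∈ Icc a b, ∀ t ∈ Icc a b, |s - t| < ε → |v s - v t| ≤ |s - t|) :
    LipschitzOnWith 1 v (Icc a b) := by
  have key : ∀ n : ℕ, ∀ s ∈ Icc a b, ∀ t ∈ Icc a b, |s - t| < 2 ^ n * ε →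
      |v s - v t| ≤ |s - t| := by
    intro n
    induction n with
    | zero => simpa using hv
    | succ n ih =>
      intro s hs t ht hst
      have hm : (s + t) / 2 ∈ Icc a b := by
        constructor <;> linarith [hs.1, hs.2, ht.1, ht.2]
      have e1 : |s - (s + t) / 2| = |s - t| / 2 := by
        rw [show s - (s + t) / 2 = (s - t) / 2 by ring, abs_div, abs_two]
      have e2 : |(s + t) / 2 - t| = |s - t| / 2 := by
        rw [show (s + t) / 2 - t = (s - t) / 2 by ring, abs_div, abs_two]
      have hlt : |s - t| / 2 < 2 ^ n * ε := by
        rw [pow_succ] at hst; linarith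
      have h1 := ih s hs _ hm (e1 ▸ hlt)
      have h2 := ih _ hm t ht (e2 ▸ hlt)
      calc |v s - v t| ≤ |v s - v ((s + t) / 2)| + |v ((s + t) / 2) - v t| := abs_sub_le _ _ _
        _ ≤ |s - t| := by rw [e1] at h1; rw [e2] at h2; linarith
  refine LipschitzOnWith.of_dist_le_mul fun s hs t ht => ?_
  obtain ⟨n, hn⟩ := pow_unbounded_of_one_lt (|s - t| / ε) one_lt_two
  rw [div_lt_iff₀ hε] at hn
  simpa [Real.dist_eq] using key n s hs t ht hn

/-- A nonnegative function which is `1`-Lipschitz at a fixed positive scale and vanishes off `A`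
has the indicator function of `A` as an upper gradient. -/
theorem isUpperGradient_indicator {u : X → ℝ} {A : Set X} {ε : ℝ} (hε : 0 < ε)
    (hu : ∀ x y, dist x y < ε → |u x - u y| ≤ dist x y) (hu0 : ∀ x, 0 ≤ u x)
    (hA : MeasurableSet A) (huA : ∀ x ∉ A, u x = 0) :
    IsUpperGradient (A.indicator 1) (fun x => (u x : EReal)) := by
  refine ⟨measurable_one.indicator hA, fun γ => ⟨fun _ => ?_, fun h => ?_⟩⟩
  · have hlip : LipschitzOnWith 1 (fun t => u (γ.toFun t)) (Icc 0 γ.length) := by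
      refine lipschitzOnWith_of_scale hε fun s hs t ht hst => ?_
      have hd : dist (γ.toFun s) (γ.toFun t) ≤ |s - t| := by
        simpa [Real.dist_eq] using γ.lipschitzOnWith.dist_le_mul s hs t ht
      exact (hu _ _ (hd.trans_lt hst)).trans hd
    -- The interval omits its left end point, so all its values are positive and are attained only
    -- in `A`.
    have hvol := γ.volume_le_integral_indicator (A := A)
      (S := Ioc (min (u γ.source) (u γ.target)) (max (u γ.source) (u γ.target))) hlip hA
      Ioc_subset_Icc_self (fun x hx => by
        by_contra hxA
        have h0 := hx.1
        rw [huA x hxA] at h0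
        exact (le_min (hu0 _) (hu0 _)).not_gt h0)
    rw [Real.volume_Ioc, max_sub_min_eq_abs'] at hvol
    rw [← EReal.coe_sub, EReal.abs_def]
    exact hvol
  · exact absurd ⟨EReal.coe_ne_top _, EReal.coe_ne_bot _, EReal.coe_ne_top _,
      EReal.coe_ne_bot _⟩ h

/-- Bounded functions of bounded support that are `1`-Lipschitz at a fixed scale are Newtonian. -/
theorem memNewtonian_of_scale {μ : Measure X} {p : ℝ} (hp : 1 ≤ p) {u : X → ℝ} {A : Set X}
    {ε M : ℝ} (hε : 0 < ε) (hu : ∀ x y, dist x y < ε → |u x - u y| ≤ dist x y)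
    (hu0 : ∀ x, 0 ≤ u x) (huM : ∀ x, u x ≤ M) (hA : MeasurableSet A) (hμA : μ A < ⊤)
    (huA : ∀ x ∉ A, u x = 0) (hum : Measurable u) :
    MemNewtonian μ p (fun x => (u x : EReal)) := by
  have hp0 : 0 < p := zero_lt_one.trans_le hp
  refine ⟨hum.coe_real_ereal.aemeasurable, ?_⟩
  refine ENNReal.rpow_lt_top_of_nonneg (by positivity) (ENNReal.add_ne_top.2 ⟨?_, ?_⟩)
  · have hle : ∀ x, ((u x : EReal).abs) ^ p
        ≤ A.indicator (fun _ => ENNReal.ofReal M ^ p) x := by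
      intro x
      by_cases hx : x ∈ A
      · rw [indicator_of_mem hx, EReal.abs_def, abs_of_nonneg (hu0 x)]
        exact ENNReal.rpow_le_rpow (ENNReal.ofReal_le_ofReal (huM x)) hp0.le
      · rw [indicator_of_notMem hx, huA x hx]
        simp [hp0]
    refine ((lintegral_mono hle).trans_lt ?_).ne
    rw [lintegral_indicator_const hA]
    exact ENNReal.mul_lt_top (ENNReal.rpow_lt_top_of_nonneg hp0.le ENNReal.ofReal_ne_top) hμA
  · refine (lt_of_le_of_lt (b := ∫⁻ x, A.indicator (1 : X → ℝ≥0∞) x ^ p ∂μ)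
      (iInf₂_le_of_le (A.indicator 1) (isUpperGradient_indicator hε hu hu0 hA huA) le_rfl) ?_).ne
    have hle : ∀ x, (A.indicator (1 : X → ℝ≥0∞) x) ^ p = A.indicator (fun _ => 1) x := by
      intro x
      by_cases hx : x ∈ A <;> simp [hx, hp0]
    simp_rw [hle]
    rw [lintegral_indicator_const hA, one_mul]
    exact hμA

end CurveIntegrals

/-! ### Uniform Lipschitz bounds from the Poincaré inequality -/

section PoincareConsequences

variable {X : Type*} [MetricSpace X] [MeasurableSpace X] [BorelSpace X]

/-- The Poincaré inequality for the functions which are `1`-Lipschitz at some scale. -/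
theorem SupportsPoincare.exists_average_le {μ : Measure X} {p : ℝ} (hp : 1 ≤ p)
    (hμ : ∀ (x : X) (r : ℝ), 0 < r → 0 < μ (ball x r) ∧ μ (ball x r) < ⊤)
    (hPI : SupportsPoincare μ p) :
    ∃ C : ℝ, 0 < C ∧ ∀ (u : X → ℝ) (z : X) (ε M : ℝ), 0 < ε →
      (∀ x y, dist x y < ε → |u x - u y| ≤ dist x y) → (∀ x, 0 ≤ u x) → (∀ x, u x ≤ M) →
      (∀ x ∉ closedBall z M, u x = 0) → ∀ (x : X) (r : ℝ), 0 < r →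
        ⨍ y in ball x r, |u y - ⨍ w in ball x r, u w ∂μ| ∂μ ≤ C * r := by
  obtain ⟨C, lam, hC, hlam, hPI⟩ := hPI
  have hp0 : 0 < p := zero_lt_one.trans_le hp
  refine ⟨C * 2, by positivity, fun u z ε M hε hu hu0 huM huA x r hr => ?_⟩
  have hM : 0 ≤ M := (hu0 x).trans (huM x)
  have hum : Measurable u := (continuous_of_scale hε hu).measurable
  have hμA : μ (closedBall z M) < ⊤ :=
    (measure_mono (closedBall_subset_ball (lt_add_one M))).trans_lt (hμ z _ (by positivity)).2
  have h := hPI x r hr _ (memNewtonian_of_scale (μ := μ) hp hε hu hu0 huM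
    measurableSet_closedBall hμA huA hum) _
    (isUpperGradient_indicator hε hu hu0 measurableSet_closedBall huA)
  simp only [EReal.toReal_coe] at h
  -- The upper gradient is at most `1`, so the right side of the Poincaré inequality reduces to `C *
  -- diam`, independently of `p`, `ε` and `M`.
  have hg : (⨍⁻ y in ball x (lam * r), (closedBall z M).indicator (1 : X → ℝ≥0∞) y ^ p ∂μ)
      ^ (1 / p) ≤ 1 := by
    refine ENNReal.rpow_le_one ?_ (by positivity)
    calc _ ≤ ⨍⁻ y in ball x (lam * r), 1 ∂μ := by
          refine lintegral_mono fun y => ?_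
          by_cases hy : y ∈ closedBall z M <;> simp [hy, hp0]
      _ = 1 := setLAverage_one (hμ x _ (by positivity)).1.ne' (hμ x _ (by positivity)).2.ne
  have hd : C * diam (ball x r) ≤ C * 2 * r := by
    rw [mul_assoc]; gcongr; exact diam_ball hr.le
  have h2 : ⨍⁻ y in ball x r, ENNReal.ofReal |u y - ⨍ w in ball x r, u w ∂μ| ∂μ
      ≤ ENNReal.ofReal (C * 2 * r) :=
    h.trans ((mul_le_mul' (ENNReal.ofReal_le_ofReal hd) hg).trans (mul_one _).le)
  rw [setLAverage_eq] at h2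
  have hint : IntegrableOn (fun y => |u y - ⨍ w in ball x r, u w ∂μ|) (ball x r) μ := by
    refine ((integrableOn_ball_of_bounded hμ hum (M := M) (fun y => ?_) hr).sub
      (integrableOn_const (hμ x r hr).2.ne)).abs
    rw [abs_of_nonneg (hu0 y)]; exact huM y
  rw [← ofReal_integral_eq_lintegral_ofReal hint (ae_of_all _ fun y => abs_nonneg _)] at h2
  have hμr : 0 < μ.real (ball x r) :=
    ENNReal.toReal_pos (hμ x r hr).1.ne' (hμ x r hr).2.ne
  rw [setAverage_eq, smul_eq_mul, inv_mul_eq_div]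
  rw [← ofReal_measureReal (hμ x r hr).2.ne, ← ENNReal.ofReal_div_of_pos hμr] at h2
  exact (ENNReal.ofReal_le_ofReal_iff (by positivity)).1 h2

/-- Under doubling and Poincaré, functions of bounded support that are `1`-Lipschitz at some scale
are Lipschitz with a uniform constant. -/
theorem SupportsPoincare.exists_uniform_lipschitz {μ : Measure X} {p : ℝ} (hp : 1 ≤ p)
    (hμ : ∀ (x : X) (r : ℝ), 0 < r → 0 < μ (ball x r) ∧ μ (ball x r) < ⊤)
    (hdoubling : IsDoubling μ) (hPI : SupportsPoincare μ p) :
    ∃ L : ℝ, 0 < L ∧ ∀ (u : X → ℝ) (z : X) (ε M : ℝ), 0 < ε →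
      (∀ x y, dist x y < ε → |u x - u y| ≤ dist x y) → (∀ x, 0 ≤ u x) → (∀ x, u x ≤ M) →
      (∀ x ∉ closedBall z M, u x = 0) → ∀ x y, |u x - u y| ≤ L * dist x y := by
  obtain ⟨C, hC, hPI⟩ := hPI.exists_average_le hp hμ
  obtain ⟨D, hD1, hD⟩ := hdoubling.exists_iterate
  -- With `r = dist x y`, in units of `D ^ 2 * C * r`: telescoping at `x` from radius `2 * r` costs
  -- `4`, telescoping at `y` from radius `r` costs `2`, and comparing the two averages costs `2`.
  refine ⟨8 * (D ^ 2 * C), by positivity, fun u z ε M hε hu hu0 huM huA => ?_⟩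
  have hum : Measurable u := (continuous_of_scale hε hu).measurable
  have hμr : ∀ x (r : ℝ), 0 < r → 0 < μ.real (ball x r) := fun x r hr =>
    ENNReal.toReal_pos (hμ x r hr).1.ne' (hμ x r hr).2.ne
  have hui : ∀ x (r : ℝ), 0 < r → IntegrableOn u (ball x r) μ := fun x r hr =>
    integrableOn_ball_of_bounded hμ hum (M := M)
      (fun y => by rw [abs_of_nonneg (hu0 y)]; exact huM y) hr
  have hdev : ∀ x (r c : ℝ), 0 < r → |(⨍ w in ball x r, u w ∂μ) - c|
      ≤ (μ.real (ball x r))⁻¹ * ∫ w in ball x r, |u w - c| ∂μ := by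
    intro x r c hr
    have e : (⨍ w in ball x r, u w ∂μ) - c
        = (μ.real (ball x r))⁻¹ * ∫ w in ball x r, (u w - c) ∂μ := by
      rw [integral_sub (hui x r hr) (integrableOn_const (hμ x r hr).2.ne), setAverage_eq,
        setIntegral_const, smul_eq_mul, smul_eq_mul, mul_sub, ← mul_assoc,
        inv_mul_cancel₀ (hμr x r hr).ne', one_mul]
    rw [e, abs_mul, abs_of_pos (inv_pos.2 (hμr x r hr))]
    gcongr
    exact abs_integral_le_integral_abs
  have hcomp : ∀ x y (r : ℝ), 0 < r → ball y (r / 2) ⊆ ball x r → dist x y ≤ r →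
      |(⨍ w in ball y (r / 2), u w ∂μ) - ⨍ w in ball x r, u w ∂μ| ≤ D ^ 2 * C * r := by
    intro x y r hr hsub hxy
    have hmeas : μ.real (ball x r) ≤ D ^ 2 * μ.real (ball y (r / 2)) := by
      have h1 : μ (ball x r) ≤ ENNReal.ofReal (D ^ 2) * μ (ball y (r / 2)) :=
        (measure_mono (ball_subset_ball' (by linarith))).trans (hD 2 y (r / 2) (by positivity))
      have := ENNReal.toReal_mono (ENNReal.mul_ne_top ENNReal.ofReal_ne_top
        (hμ y (r / 2) (by positivity)).2.ne) h1
      rwa [ENNReal.toReal_mul, ENNReal.toReal_ofReal (by positivity)] at this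
    set c := ⨍ w in ball x r, u w ∂μ with hc
    have hint : IntegrableOn (fun w => |u w - c|) (ball x r) μ :=
      ((hui x r hr).sub (integrableOn_const (hμ x r hr).2.ne)).abs
    have hav := hPI u z ε M hε hu hu0 huM huA x r hr
    rw [setAverage_eq, smul_eq_mul, inv_mul_eq_div, div_le_iff₀ (hμr x r hr)] at hav
    refine (hdev y (r / 2) c (by positivity)).trans ?_
    have hr2 := hμr y (r / 2) (by positivity)
    rw [inv_mul_le_iff₀ hr2]
    calc ∫ w in ball y (r / 2), |u w - c| ∂μ ≤ ∫ w in ball x r, |u w - c| ∂μ :=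
          setIntegral_mono_set hint (ae_of_all _ fun w => abs_nonneg _)
            (LE.le.eventuallyLE hsub)
      _ ≤ C * r * μ.real (ball x r) := hav
      _ ≤ C * r * (D ^ 2 * μ.real (ball y (r / 2))) := by gcongr
      _ = _ := by ring
  have htel : ∀ x (r : ℝ), 0 < r → |u x - ⨍ w in ball x r, u w ∂μ| ≤ 2 * (D ^ 2 * C * r) := by
    intro x r hr
    -- The scale `ε` enters only here, qualitatively: it gives convergence of the averages at every
    -- point but does not affect the final constant.
    have hlim : Tendsto (fun n : ℕ => ⨍ w in ball x (r / 2 ^ n), u w ∂μ) atTop (𝓝 (u x)) := by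
      have h0 : Tendsto (fun n : ℕ => r / 2 ^ n) atTop (𝓝 0) :=
        tendsto_const_nhds.div_atTop (tendsto_pow_atTop_atTop_of_one_lt one_lt_two)
      rw [tendsto_iff_dist_tendsto_zero]
      refine squeeze_zero' (Eventually.of_forall fun _ => dist_nonneg) ?_ h0
      filter_upwards [h0.eventually (gt_mem_nhds hε)] with n hn
      have hrn : 0 < r / 2 ^ n := by positivity
      refine (hdev x _ (u x) hrn).trans ?_
      rw [inv_mul_le_iff₀ (hμr x _ hrn)]
      calc ∫ w in ball x (r / 2 ^ n), |u w - u x| ∂μ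
          ≤ ∫ w in ball x (r / 2 ^ n), r / 2 ^ n ∂μ := by
            refine setIntegral_mono_on
              ((hui x _ hrn).sub (integrableOn_const (hμ x _ hrn).2.ne)).abs
              (integrableOn_const (hμ x _ hrn).2.ne) measurableSet_ball fun w hw => ?_
            exact (hu w x ((mem_ball.1 hw).trans hn)).trans (mem_ball.1 hw).le
        _ = μ.real (ball x (r / 2 ^ n)) * (r / 2 ^ n) := by
            rw [setIntegral_const, smul_eq_mul]
    have hgeo := dist_le_of_le_geometric_two_of_tendsto₀ (C := 2 * (D ^ 2 * C * r)) (fun n => ?_) hlim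
    · rw [pow_zero, div_one, dist_comm] at hgeo
      simpa [Real.dist_eq] using hgeo
    · have hrn : 0 < r / 2 ^ n := by positivity
      have := hcomp x x (r / 2 ^ n) hrn (ball_subset_ball (by linarith)) (by simpa using hrn.le)
      rw [dist_comm, Real.dist_eq, pow_succ, ← div_div]
      refine this.trans (le_of_eq ?_)
      field_simp
  intro x y
  rcases eq_or_ne x y with rfl | hxy
  · simp
  have hr : 0 < dist x y := dist_pos.2 hxy
  set r := dist x y with hrdef
  have h1 := htel x (2 * r) (by positivity)
  have h2 := htel y r hr
  have h3 := hcomp x y (2 * r) (by positivity)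
    (ball_subset_ball' (by rw [dist_comm y x]; linarith)) (by linarith)
  rw [show 2 * r / 2 = r by ring] at h3
  rw [abs_le] at *
  constructor <;> nlinarith [h1.1, h1.2, h2.1, h2.2, h3.1, h3.2]

end PoincareConsequences

/-! ### Short chains of points and local path connectedness -/

section Chains

variable {X : Type*} [MetricSpace X]

/-- `StepChain ε x y l`: there is a finite chain from `x` to `y` of total length `l` with all
steps of length less than `ε`. -/
inductive StepChain (ε : ℝ) (x : X) : X → ℝ → Prop
  | refl : StepChain ε x x 0
  | step {y z : X} {l : ℝ} : StepChain ε x y l → dist y z < ε → StepChain ε x z (l + dist y z)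

theorem StepChain.nonneg {ε : ℝ} {x y : X} {l : ℝ} (h : StepChain ε x y l) : 0 ≤ l := by
  induction h with
  | refl => exact le_rfl
  | step _ _ ih => positivity

theorem StepChain.dist_le {ε : ℝ} {x y : X} {l : ℝ} (h : StepChain ε x y l) : dist x y ≤ l := by
  induction h with
  | refl => simp
  | @step y z l _ _ ih => linarith [dist_triangle x y z]

/-- A chain with small steps is the trace of a coarsely `1`-Lipschitz map. -/
theorem StepChain.exists_coarse_curve {ε : ℝ} {x y : X} {l : ℝ} (hε : 0 < ε)
    (h : StepChain ε x y l) :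
    ∃ f : ℝ → X, f 0 = x ∧ (∀ t, l ≤ t → f t = y) ∧
      ∀ s t, s ≤ t → dist (f s) (f t) ≤ t - s + ε := by
  induction h with
  | refl =>
    exact ⟨fun _ => x, rfl, fun _ _ => rfl, fun s t hst => by rw [dist_self]; linarith⟩
  | @step y z l h hyz ih =>
    obtain ⟨f, hf0, hfl, hf⟩ := ih
    -- The curve waits at `y` during the time `dist y z` and then jumps to `z`; the additive `ε`
    -- absorbs one jump.
    refine ⟨fun t => if t < l + dist y z then f t else z, ?_, fun t ht => if_neg ht.not_gt, ?_⟩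
    · by_cases h0 : 0 < l + dist y z
      · simp [h0, hf0]
      · have h1 := (h.step hyz).dist_le.trans (not_lt.1 h0)
        simp [h0, dist_le_zero.1 h1]
    · intro s t hst
      by_cases ht : t < l + dist y z
      · simp only [ht, hst.trans_lt ht, if_true]
        exact hf s t hst
      by_cases hs : s < l + dist y z
      · simp only [ht, hs, if_true, if_false]
        rcases le_total s l with hsl | hsl
        · have h1 := hf s l hsl
          rw [hfl l le_rfl] at h1
          linarith [dist_triangle (f s) y z]
        · rw [hfl s hsl]; linarith
      · simp only [ht, hs, if_false, dist_self]; linarith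

/-- In a proper space, points that are joined by chains of bounded length with arbitrarily small
steps are joined by a curve. -/
theorem joinedIn_of_stepChain [ProperSpace X] {x y : X} {L : ℝ} (hL : 0 ≤ L)
    (h : ∀ ε, 0 < ε → ∃ l ≤ L, StepChain ε x y l) : JoinedIn (closedBall x L) x y := by
  have hn : ∀ n : ℕ, ∃ f : ℝ → X, f 0 = x ∧ f 1 = y ∧
      ∀ s t, s ≤ t → dist (f s) (f t) ≤ L * (t - s) + 1 / ((n : ℝ) + 1) := by
    intro n
    obtain ⟨l, hl, hc⟩ := h (1 / ((n : ℝ) + 1)) (by positivity)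
    obtain ⟨f, h0, h1, hf⟩ := hc.exists_coarse_curve (by positivity)
    refine ⟨fun t => f (L * t), by simpa using h0, h1 _ (by simpa using hl), fun s t hst => ?_⟩
    exact (hf (L * s) (L * t) (by gcongr)).trans (le_of_eq (by ring))
  choose f hf0 hf1 hf using hn
  have hbdd : ∀ t ∈ Icc (0 : ℝ) 1, ∀ n, f n t ∈ closedBall x (L + 1) := by
    intro t ht n
    have h1 := hf n 0 t ht.1
    rw [hf0] at h1
    have h2 : 1 / ((n : ℝ) + 1) ≤ 1 := by
      rw [div_le_one (by positivity)]
      linarith [Nat.cast_nonneg (α := ℝ) n]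
    rw [mem_closedBall']
    nlinarith [ht.2]
  -- An ultralimit provides limits at all `t` at once, without extracting subsequences; the jumps
  -- disappear and a Lipschitz curve remains.
  have hlim : ∀ t : ℝ, ∃ z : X, t ∈ Icc (0 : ℝ) 1 →
      Tendsto (fun n => f n t) (hyperfilter ℕ : Filter ℕ) (𝓝 z) := by
    intro t
    by_cases ht : t ∈ Icc (0 : ℝ) 1
    · obtain ⟨z, -, hz⟩ := (isCompact_closedBall x (L + 1)).ultrafilter_le_nhds
        ((hyperfilter ℕ).map fun n => f n t)
          (le_principal_iff.2 (Ultrafilter.mem_map.2 (univ_mem' (hbdd t ht))))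
      exact ⟨z, fun _ => hz⟩
    · exact ⟨x, fun h => absurd h ht⟩
  choose g hg using hlim
  have hinv : Tendsto (fun n : ℕ => 1 / ((n : ℝ) + 1)) (hyperfilter ℕ : Filter ℕ) (𝓝 0) :=
    tendsto_one_div_add_atTop_nhds_zero_nat.mono_left Nat.hyperfilter_le_atTop
  have hglip : ∀ s ∈ Icc (0 : ℝ) 1, ∀ t ∈ Icc (0 : ℝ) 1, s ≤ t →
      dist (g s) (g t) ≤ L * (t - s) := by
    intro s hs t ht hst
    have h1 : Tendsto (fun n : ℕ => L * (t - s) + 1 / ((n : ℝ) + 1))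
        (hyperfilter ℕ : Filter ℕ) (𝓝 (L * (t - s))) := by
      simpa using hinv.const_add (L * (t - s))
    exact le_of_tendsto_of_tendsto ((hg s hs).dist (hg t ht)) h1
      (Eventually.of_forall fun n => hf n s t hst)
  have hg0 : g 0 = x := by
    refine tendsto_nhds_unique (hg 0 (by simp)) ?_
    simp [hf0]
  have hg1 : g 1 = y := by
    refine tendsto_nhds_unique (hg 1 (by simp)) ?_
    simp [hf1]
  refine JoinedIn.ofLine (f := g) ?_ hg0 hg1 ?_
  · have : LipschitzOnWith L.toNNReal g (Icc 0 1) := by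
      refine LipschitzOnWith.of_dist_le_mul fun s hs t ht => ?_
      rw [Real.coe_toNNReal _ hL, Real.dist_eq]
      rcases le_total s t with hst | hst
      · rw [abs_sub_comm, abs_of_nonneg (sub_nonneg.2 hst)]
        exact hglip s hs t ht hst
      · rw [dist_comm, abs_of_nonneg (sub_nonneg.2 hst)]
        exact hglip t ht s hs hst
    exact this.continuousOn
  · rintro _ ⟨t, ht, rfl⟩
    have := hglip 0 (by simp) t ht ht.1
    rw [hg0] at this
    rw [mem_closedBall']
    nlinarith [ht.2]

variable [MeasurableSpace X] [BorelSpace X]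

/-- Under doubling and Poincaré, points are joined by short chains with arbitrarily small steps. -/
theorem SupportsPoincare.exists_stepChain {μ : Measure X} {p : ℝ} (hp : 1 ≤ p)
    (hμ : ∀ (x : X) (r : ℝ), 0 < r → 0 < μ (ball x r) ∧ μ (ball x r) < ⊤)
    (hdoubling : IsDoubling μ) (hPI : SupportsPoincare μ p) :
    ∃ L : ℝ, 0 < L ∧ ∀ x y : X, ∀ ε, 0 < ε → ∃ l ≤ L * dist x y, StepChain ε x y l := by
  obtain ⟨L, hL, hlip⟩ := hPI.exists_uniform_lipschitz hp hμ hdoubling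
  refine ⟨L + 1, by positivity, fun x y ε hε => ?_⟩
  rcases eq_or_ne x y with rfl | hxy
  · exact ⟨0, by simp, .refl⟩
  have hd : 0 < dist x y := dist_pos.2 hxy
  -- The test function `u` is `max 0 (M - l)` with `l` the `ε`-chain distance from `x`, and `0` at
  -- points no chain reaches. As `u x = M`, the Lipschitz bound leaves `u y ≥ M - L * dist x y =
  -- dist x y > 0`, so a chain shorter than `M` reaches `y`.
  set M := (L + 1) * dist x y with hM
  have hM0 : 0 < M := by positivity
  let S : X → Set ℝ := fun z => insert 0 {a | ∃ l, StepChain ε x z l ∧ a = M - l}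
  let u : X → ℝ := fun z => sSup (S z)
  have hSM : ∀ z, ∀ a ∈ S z, a ≤ M := by
    rintro z a (rfl | ⟨l, hl, rfl⟩)
    · exact hM0.le
    · linarith [hl.nonneg]
  have hbdd : ∀ z, BddAbove (S z) := fun z => ⟨M, hSM z⟩
  have hne : ∀ z, (S z).Nonempty := fun z => ⟨0, mem_insert _ _⟩
  have hu0 : ∀ z, 0 ≤ u z := fun z => le_csSup (hbdd z) (mem_insert _ _)
  have huM : ∀ z, u z ≤ M := fun z => csSup_le (hne z) (hSM z)
  have hupos : ∀ z, 0 < u z → ∃ l < M, StepChain ε x z l := by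
    intro z hz
    obtain ⟨a, ha, ha0⟩ := exists_lt_of_lt_csSup (hne z) hz
    rcases ha with rfl | ⟨l, hl, rfl⟩
    · exact absurd ha0 (lt_irrefl _)
    · exact ⟨l, by linarith, hl⟩
  have hstep : ∀ z w, dist z w < ε → u z - u w ≤ dist z w := by
    intro z w hzw
    rw [sub_le_iff_le_add]
    refine csSup_le (hne z) ?_
    rintro a (rfl | ⟨l, hl, rfl⟩)
    · linarith [hu0 w, dist_nonneg (x := z) (y := w)]
    · have : M - (l + dist z w) ≤ u w :=
        le_csSup (hbdd w) (mem_insert_of_mem _ ⟨_, hl.step hzw, rfl⟩)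
      linarith
  have hux : u x = M := le_antisymm (huM x)
    (le_csSup (hbdd x) (mem_insert_of_mem _ ⟨0, .refl, by simp⟩))
  have h := hlip u x ε M hε (fun z w hzw => by
    rw [abs_sub_le_iff]
    exact ⟨hstep z w hzw, by rw [dist_comm]; exact hstep w z (by rwa [dist_comm])⟩) hu0 huM
    (fun z hz => by
      by_contra hne0
      obtain ⟨l, hl, hc⟩ := hupos z (lt_of_le_of_ne (hu0 z) (Ne.symm hne0))
      exact hz (mem_closedBall'.2 (hc.dist_le.trans hl.le))) x y
  obtain ⟨l, hl, hc⟩ := hupos y (by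
    rw [hux] at h
    have := (le_abs_self _).trans h
    rw [hM] at this
    nlinarith)
  exact ⟨l, hl.le, hc⟩

/-- A complete doubling space supporting a Poincaré inequality is locally path connected. -/
theorem SupportsPoincare.locallyPathConnectedSpace [CompleteSpace X] {μ : Measure X} {p : ℝ}
    (hp : 1 ≤ p) (hμ : ∀ (x : X) (r : ℝ), 0 < r → 0 < μ (ball x r) ∧ μ (ball x r) < ⊤)
    (hdoubling : IsDoubling μ) (hPI : SupportsPoincare μ p) : LocallyPathConnectedSpace X := by
  have := properSpace_of_isDoubling hμ hdoubling
  obtain ⟨L, hL, hchain⟩ := hPI.exists_stepChain hp hμ hdoubling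
  rw [locallyPathConnectedSpace_iff_pathComponentIn_mem_nhds]
  intro x U hU hx
  obtain ⟨r, hr, hrU⟩ := Metric.isOpen_iff.1 hU x hx
  refine mem_of_superset (ball_mem_nhds x (show 0 < r / L by positivity)) fun y hy => ?_
  rw [mem_ball', lt_div_iff₀ hL] at hy
  refine (joinedIn_of_stepChain (by positivity) (hchain x y)).mono
    ((closedBall_subset_ball ?_).trans hrU)
  linarith

end Chains

/-! ### Ends with one-point impression are prime -/

section PrimeChains

variable {X : Type*} [MetricSpace X] {Ω : Set X}

theorem Chain.antitone (c : Chain Ω) : Antitone c.sets := antitone_nat_of_succ_le c.subset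

/-- Otherwise the interior and the exterior of `G` would separate `F`. -/
theorem exists_mem_frontier_of_isPreconnected {F G : Set X} (hF : IsPreconnected F)
    (hFG : (F ∩ G).Nonempty) (hsub : ¬ F ⊆ G) : (F ∩ frontier G).Nonempty := by
  by_contra hne
  rw [not_nonempty_iff_eq_empty] at hne
  obtain ⟨y, hyF, hyG⟩ := hFG
  obtain ⟨z, hzF, hzG⟩ := not_subset.1 hsub
  have hint : ∀ w ∈ F, w ∈ closure G → w ∈ interior G := fun w hw hwc => by
    by_contra hwi
    exact (hne ▸ (⟨hw, hwc, hwi⟩ : w ∈ F ∩ frontier G) : w ∈ (∅ : Set X))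
  obtain ⟨w, -, hw1, hw2⟩ := hF (interior G) (closure G)ᶜ isOpen_interior
    isClosed_closure.isOpen_compl
    (fun w hw => by
      by_cases hwc : w ∈ closure G
      · exact Or.inl (hint w hw hwc)
      · exact Or.inr hwc)
    ⟨y, hyF, hint y hyF (subset_closure hyG)⟩
    ⟨z, hzF, fun hzc => hzG (interior_subset (hint z hzF hzc))⟩
  exact hw2 (subset_closure (interior_subset hw1))

/-- A small connected subset of `Ω` meeting a set of a chain is contained in the preceding set. -/
theorem Chain.exists_subset_of_meets (c : Chain Ω) (k : ℕ) :
    ∃ δ : ℝ, 0 < δ ∧ ∀ (F : Set X) (x : X), IsPreconnected F → F ⊆ Ω → F ⊆ ball x δ →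
      (F ∩ c.sets (k + 1)).Nonempty → F ⊆ c.sets k := by
  obtain ⟨δ, hδ, hsep⟩ := c.separated k
  -- A set leaving `E_k` would cross both relative boundaries, which are `δ` apart, inside a ball of
  -- radius `δ / 2`.
  refine ⟨δ / 2, by positivity, fun F x hF hFΩ hFx hmeet => ?_⟩
  by_contra hnot
  obtain ⟨y, hyF, hy⟩ := exists_mem_frontier_of_isPreconnected hF hmeet
    (fun h => hnot (h.trans (c.subset k)))
  obtain ⟨z, hzF, hz⟩ := exists_mem_frontier_of_isPreconnected hF
    (hmeet.mono (inter_subset_inter_right F (c.subset k))) hnot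
  have h1 := hsep y ⟨hFΩ hyF, hy⟩ z ⟨hFΩ hzF, hz⟩
  have h2 := mem_ball.1 (hFx hyF)
  have h3 := mem_ball'.1 (hFx hzF)
  linarith [dist_triangle y x z]

variable [ProperSpace X]

theorem Chain.isCompact_closure (c : Chain Ω) (k : ℕ) : IsCompact (closure (c.sets k)) :=
  (c.acceptable k).isBounded.isCompact_closure

theorem Chain.impression_nonempty (c : Chain Ω) : c.impression.Nonempty :=
  IsCompact.nonempty_iInter_of_sequence_nonempty_isCompact_isClosed _
    (fun k => closure_mono (c.subset k))
    (fun k => (c.acceptable k).isConnected.nonempty.closure)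
    (c.isCompact_closure 0) (fun _ => isClosed_closure)

/-- The closures are compact and decrease to `{x}`, so they eventually enter every neighbourhood of
`x`. -/
theorem Chain.exists_subset_ball {c : Chain Ω} {x : X} (hc : c.impression = {x}) {r : ℝ}
    (hr : 0 < r) : ∃ l, c.sets l ⊆ ball x r := by
  have hdir : Directed (· ⊇ ·) fun k => closure (c.sets k) :=
    Antitone.directed_ge fun i j hij => closure_mono (c.antitone hij)
  obtain ⟨l, hl⟩ := exists_subset_nhds_of_isCompact hdir c.isCompact_closure (U := ball x r)
    (fun y hy => by
      have : y ∈ c.impression := hy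
      rw [hc, mem_singleton_iff] at this
      rw [this]
      exact ball_mem_nhds x hr)
  exact ⟨l, subset_closure.trans hl⟩

/-- A chain with a one-point impression divides each chain that divides it. -/
theorem Chain.Divides.symm_of_impression {c d : Chain Ω} {x : X} (hc : c.impression = {x})
    (h : d.Divides c) : c.Divides d := by
  intro k
  obtain ⟨δ, hδ, hd⟩ := d.exists_subset_of_meets k
  obtain ⟨l, hl⟩ := c.exists_subset_ball hc hδ
  refine ⟨l, hd _ x (c.acceptable l).isConnected.isPreconnected
    (c.acceptable l).ssubset.subset hl ?_⟩
  obtain ⟨m, hm⟩ := h l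
  obtain ⟨y, hy⟩ := (d.acceptable (max m (k + 1))).isConnected.nonempty
  exact ⟨y, hm (d.antitone (le_max_left _ _) hy), d.antitone (le_max_right _ _) hy⟩

/-- An end with a one-point impression is a prime end. -/
theorem Chain.isPrime_of_impression {c : Chain Ω} {x : X} (hc : c.impression = {x}) :
    c.toEnd.IsPrime := by
  rintro ⟨d⟩ hd
  exact Quotient.sound (s := chainSetoid Ω)
    ⟨hd, Chain.Divides.symm_of_impression hc hd⟩

end PrimeChains

/-! ### Chains selected by ultrafilters, and accessibility -/

section FinitelyConnected

variable {X : Type*} [MetricSpace X] {Ω : Set X}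

/-- If `Ω` is finitely connected at `x`, then each ultrafilter on `Ω` converging to `x` selects a
component of each `B(x, r) ∩ Ω`. -/
theorem FinitelyConnectedAt.exists_component_mem {x : X} (h : FinitelyConnectedAt Ω x)
    (𝒱 : Ultrafilter X) (hx : (𝒱 : Filter X) ≤ 𝓝 x) (hΩ : Ω ∈ 𝒱) {r : ℝ} (hr : 0 < r) :
    ∃ y ∈ ball x r ∩ Ω, connectedComponentIn (ball x r ∩ Ω) y ∈ 𝒱 := by
  obtain ⟨G, hG, hxG, hGr, hfin⟩ := h r hr
  have hmem : G ∩ Ω ∈ 𝒱 := inter_mem (hx (hG.mem_nhds hxG)) hΩ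
  have hU : ⋃₀ {A : Set X | ∃ y ∈ G ∩ Ω, A = connectedComponentIn (G ∩ Ω) y} ∈ 𝒱 :=
    mem_of_superset hmem fun y hy => ⟨_, ⟨y, hy, rfl⟩, mem_connectedComponentIn hy⟩
  obtain ⟨_, ⟨y, hy, rfl⟩, hA⟩ := (Ultrafilter.finite_sUnion_mem_iff hfin).1 hU
  exact ⟨y, ⟨hGr hy.1, hy.2⟩,
    mem_of_superset hA (connectedComponentIn_mono y (inter_subset_inter_left _ hGr))⟩

/-- The relative boundary of a component of `B(x, r) ∩ Ω` lies on the sphere of radius `r`. -/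
theorem dist_eq_of_mem_frontier_component [LocallyConnectedSpace X] (hΩ : IsOpen Ω) {x y z : X}
    {r : ℝ} (hz : z ∈ Ω ∩ frontier (connectedComponentIn (ball x r ∩ Ω) y)) : dist z x = r := by
  have hopen : IsOpen (connectedComponentIn (ball x r ∩ Ω) y) :=
    (isOpen_ball.inter hΩ).connectedComponentIn
  refine le_antisymm ?_ (not_lt.1 fun hlt => ?_)
  · exact closure_ball_subset_closedBall
      (closure_mono ((connectedComponentIn_subset _ _).trans inter_subset_left) hz.2.1)
  · have hzB : z ∈ ball x r ∩ Ω := ⟨hlt, hz.1⟩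
    obtain ⟨w, hw1, hw2⟩ := mem_closure_iff.1 hz.2.1 _
      (isOpen_ball.inter hΩ).connectedComponentIn (mem_connectedComponentIn hzB)
    have heq : connectedComponentIn (ball x r ∩ Ω) z = connectedComponentIn (ball x r ∩ Ω) y :=
      (connectedComponentIn_eq hw1).trans (connectedComponentIn_eq hw2).symm
    exact hz.2.2 (hopen.interior_eq.symm ▸ heq ▸ mem_connectedComponentIn hzB)

/-- Each ultrafilter on `Ω` converging to a boundary point `x` at which `Ω` is finitely connected
is carried by a chain of open sets shrinking to `x`. -/
theorem FinitelyConnectedAt.exists_chain [LocallyConnectedSpace X] (hΩ : IsOpen Ω) {x : X}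
    (hx : x ∈ frontier Ω) (h : FinitelyConnectedAt Ω x) (𝒱 : Ultrafilter X)
    (h𝒱x : (𝒱 : Filter X) ≤ 𝓝 x) (h𝒱 : Ω ∈ 𝒱) :
    ∃ c : Chain Ω, c.impression = {x} ∧ (∀ k, c.sets k ∈ 𝒱) ∧ (∀ k, IsOpen (c.sets k)) ∧
      ∀ k, c.sets k ⊆ ball x (1 / ((k : ℝ) + 1)) := by
  have hxΩ : x ∉ Ω := fun hxm => hx.2 (hΩ.interior_eq.symm ▸ hxm)
  obtain ⟨y₀, hy₀⟩ := 𝒱.nonempty_of_mem h𝒱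
  have hd : 0 < dist y₀ x := dist_pos.2 fun h => hxΩ (h ▸ hy₀)
  -- Radii at most `dist y₀ x` keep `y₀` out of the components, which are therefore proper subsets
  -- of `Ω`.
  let r : ℕ → ℝ := fun k => min 1 (dist y₀ x) / ((k : ℝ) + 1)
  have hr : ∀ k, 0 < r k := fun k => by positivity
  have hrlt : ∀ k, r (k + 1) < r k := fun k => by
    simp only [r]
    have : 0 < min 1 (dist y₀ x) := by positivity
    gcongr
    simp
  have hr1 : ∀ k, r k ≤ 1 / ((k : ℝ) + 1) := fun k => by
    simp only [r]; gcongr; exact min_le_left _ _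
  have hrd : ∀ k, r k ≤ dist y₀ x := fun k =>
    (div_le_self (by positivity) (by simp)).trans (min_le_right _ _)
  choose y hy hyV using fun k => h.exists_component_mem 𝒱 h𝒱x h𝒱 (hr k)
  let F : ℕ → Set X := fun k => connectedComponentIn (ball x (r k) ∩ Ω) (y k)
  have hFsub : ∀ k, F k ⊆ ball x (r k) ∩ Ω := fun k => connectedComponentIn_subset _ _
  have hFcl : ∀ k, x ∈ closure (F k) := fun k => by
    refine mem_closure_iff_nhds.2 fun t ht => ?_
    exact 𝒱.nonempty_of_mem (inter_mem (h𝒱x ht) (hyV k))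
  have himp : ⋂ k, closure (F k) = {x} := by
    refine Subset.antisymm (fun z hz => ?_) (singleton_subset_iff.2 (mem_iInter.2 hFcl))
    have hle : ∀ k : ℕ, dist z x ≤ 1 / ((k : ℝ) + 1) := fun k =>
      (mem_closedBall.1 (closure_ball_subset_closedBall
        (closure_mono ((hFsub k).trans inter_subset_left) (mem_iInter.1 hz k)))).trans (hr1 k)
    exact dist_le_zero.1 (ge_of_tendsto' tendsto_one_div_add_atTop_nhds_zero_nat hle)
  refine ⟨⟨F, fun k => ⟨isBounded_ball.subset ((hFsub k).trans inter_subset_left),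
    isConnected_connectedComponentIn_iff.2 (hy k), ⟨(hFsub k).trans inter_subset_right, ?_⟩,
    ⟨x, hFcl k, hx⟩⟩, fun k => ?_, fun k => ⟨r k - r (k + 1), sub_pos.2 (hrlt k), ?_⟩,
    himp ▸ singleton_subset_iff.2 hx⟩, himp, hyV,
    fun k => (isOpen_ball.inter hΩ).connectedComponentIn,
    fun k => (hFsub k).trans (inter_subset_left.trans (ball_subset_ball (hr1 k)))⟩
  · intro hsub
    exact (mem_ball.1 (hFsub k (hsub hy₀)).1).not_ge (hrd k)
  -- Successive components belong to the same ultrafilter, so they meet, which forces nesting.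
  · obtain ⟨z, hz1, hz2⟩ := 𝒱.nonempty_of_mem (inter_mem (hyV (k + 1)) (hyV k))
    have h1 : F (k + 1) ⊆ connectedComponentIn (ball x (r k) ∩ Ω) z :=
      isPreconnected_connectedComponentIn.subset_connectedComponentIn hz1
        ((hFsub (k + 1)).trans (inter_subset_inter_left _ (ball_subset_ball (hrlt k).le)))
    rwa [← connectedComponentIn_eq hz2] at h1
  · intro z hz w hw
    have h1 := dist_eq_of_mem_frontier_component hΩ hz
    have h2 := dist_eq_of_mem_frontier_component hΩ hw
    rw [← h1, ← h2, sub_le_iff_le_add, dist_comm z w]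
    exact dist_triangle w z x

/-- If `Ω` is finitely connected at the boundary, each chain is divisible by a chain with a
one-point impression. -/
theorem FinitelyConnectedAtBoundary.exists_divides [ProperSpace X] [LocallyConnectedSpace X]
    (hΩ : IsOpen Ω) (h : FinitelyConnectedAtBoundary Ω) (d : Chain Ω) :
    ∃ (c : Chain Ω) (x : X), x ∈ frontier Ω ∧ c.impression = {x} ∧ c.Divides d := by
  obtain ⟨x, hx⟩ := d.impression_nonempty
  have hxf : x ∈ frontier Ω := d.impression_subset hx
  -- An ultrafilter below this infimum converges to `x` and contains every set of `d`, so the chain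
  -- it selects meets every set of `d`.
  have hne : NeBot (⨅ k, 𝓝[d.sets k] x) :=
    iInf_neBot_of_directed' (Antitone.directed_ge fun i j hij => nhdsWithin_mono x (d.antitone hij))
      fun k => mem_closure_iff_nhdsWithin_neBot.1 (mem_iInter.1 hx k)
  have hle : ∀ k, (Ultrafilter.of (⨅ k, 𝓝[d.sets k] x) : Filter X) ≤ 𝓝[d.sets k] x :=
    fun k => (Ultrafilter.of_le _).trans (iInf_le _ k)
  have hmem : ∀ k, d.sets k ∈ Ultrafilter.of (⨅ k, 𝓝[d.sets k] x) :=
    fun k => hle k self_mem_nhdsWithin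
  obtain ⟨c, hcx, hcV, -, -⟩ := (h x hxf).exists_chain hΩ hxf _
    ((hle 0).trans nhdsWithin_le_nhds)
    (mem_of_superset (hmem 0) (d.acceptable 0).ssubset.subset)
  refine ⟨c, x, hxf, hcx, fun k => ?_⟩
  obtain ⟨δ, hδ, hd⟩ := d.exists_subset_of_meets k
  obtain ⟨l, hl⟩ := c.exists_subset_ball hcx hδ
  exact ⟨l, hd _ x (c.acceptable l).isConnected.isPreconnected (c.acceptable l).ssubset.subset hl
    (Ultrafilter.nonempty_of_mem (inter_mem (hcV l) (hmem (k + 1))))⟩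

/-- A point to which a chain of path connected sets shrinks is accessible. -/
theorem Chain.isAccessible {c : Chain Ω} {x : X} (hx : x ∈ frontier Ω)
    (hc : ∀ k, IsPathConnected (c.sets k)) (hcx : ∀ k, c.sets k ⊆ ball x (1 / ((k : ℝ) + 1))) :
    IsAccessible Ω x := by
  refine ⟨hx, ?_⟩
  choose y hy using fun k => (c.acceptable k).isConnected.nonempty
  have hj : ∀ k, JoinedIn (c.sets k) (y k) (y (k + 1)) := fun k =>
    (hc k).joinedIn _ (hy k) _ (c.subset k (hy (k + 1)))
  let G : ℕ → ℝ → X := fun n => (hj n).somePath.extend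
  have hG : ∀ n, Continuous (G n) := fun n => (hj n).somePath.continuous_extend
  -- The paths are concatenated on `[0, ∞)`, the `n`-th one staying in `c.sets n`; the change of
  -- variable `g` below then compresses `[0, ∞)` to `[0, 1)`.
  let f : ℝ → X := fun t => G ⌊t⌋₊ (t - ⌊t⌋₊)
  have hfmem : ∀ t, f t ∈ c.sets ⌊t⌋₊ := by
    intro t
    have : f t ∈ range (hj ⌊t⌋₊).somePath.extend := mem_range_self _
    rw [Path.extend_range] at this
    obtain ⟨s, hs⟩ := this
    exact hs ▸ (hj ⌊t⌋₊).somePath_mem s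
  have hfeq : ∀ n : ℕ, EqOn f (fun t => G n (t - n)) (Icc n (n + 1)) := by
    intro n t ht
    rcases ht.2.lt_or_eq with hlt | rfl
    · have : ⌊t⌋₊ = n := (Nat.floor_eq_iff (n.cast_nonneg.trans ht.1)).2 ⟨ht.1, hlt⟩
      simp only [f, this]
    · have : ⌊(n : ℝ) + 1⌋₊ = n + 1 := by exact_mod_cast Nat.floor_natCast (n + 1)
      simp [f, this, G]
  have hlf : LocallyFinite fun n : ℕ => Icc (n : ℝ) (n + 1) := by
    intro t
    refine ⟨Iio (t + 1), Iio_mem_nhds (lt_add_one t), (finite_Iic ⌈t + 1⌉₊).subset ?_⟩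
    rintro n ⟨s, hs1, hs2⟩
    exact_mod_cast (hs1.1.trans (le_of_lt hs2)).trans (Nat.le_ceil (t + 1))
  have hfc : ContinuousOn f (Ici 0) := by
    refine (hlf.continuousOn_iUnion (fun _ => isClosed_Icc) fun n =>
      ContinuousOn.congr ((hG n).comp (continuous_sub_right _)).continuousOn
        (hfeq n)).mono fun t ht => ?_
    exact mem_iUnion.2 ⟨⌊t⌋₊, Nat.floor_le ht, (Nat.lt_floor_add_one t).le⟩
  have hfdist : ∀ t, dist (f t) x ≤ 1 / ((⌊t⌋₊ : ℝ) + 1) := fun t =>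
    (mem_ball.1 (hcx _ (hfmem t))).le
  have hflim : Tendsto f atTop (𝓝 x) := by
    rw [tendsto_iff_dist_tendsto_zero]
    exact squeeze_zero (fun _ => dist_nonneg) hfdist
      (tendsto_one_div_add_atTop_nhds_zero_nat.comp tendsto_nat_floor_atTop)
  let g : ℝ → ℝ := fun t => (1 - t)⁻¹ - 1
  refine ⟨fun t => if t < 1 then f (g t) else x, ?_, by simp, fun t ht => ?_⟩
  · intro t ht
    rcases ht.2.lt_or_eq with hlt | rfl
    · have hev : (fun t => if t < 1 then f (g t) else x) =ᶠ[𝓝[Icc 0 1] t] fun t => f (g t) := by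
        filter_upwards [nhdsWithin_le_nhds (Iio_mem_nhds hlt)] with s hs
        exact if_pos hs
      refine ContinuousWithinAt.congr_of_eventuallyEq ?_ hev (if_pos hlt)
      have hg : ContinuousWithinAt g (Icc 0 1 ∩ Iio 1) t := by
        refine ContinuousAt.continuousWithinAt ?_
        exact ((continuousAt_const.sub continuousAt_id).inv₀ (sub_pos.2 hlt).ne').sub
          continuousAt_const
      have hmaps : MapsTo g (Icc 0 1 ∩ Iio 1) (Ici 0) := fun s hs =>
        sub_nonneg.2 ((one_le_inv₀ (sub_pos.2 hs.2)).2 (sub_le_self _ hs.1.1))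
      have := (hfc (g t) (hmaps ⟨ht, hlt⟩)).comp hg hmaps
      exact (continuousWithinAt_inter (Iio_mem_nhds hlt)).1 this
    · rw [ContinuousWithinAt, if_neg (lt_irrefl _)]
      refine Tendsto.if ?_ tendsto_const_nhds
      have h0 : Tendsto (fun t : ℝ => 1 - t) (𝓝[<] 1) (𝓝[>] 0) := by
        refine tendsto_nhdsWithin_iff.2 ⟨?_, ?_⟩
        · exact (tendsto_const_nhds.sub tendsto_id).mono_left nhdsWithin_le_nhds |>.trans (by simp)
        · filter_upwards [self_mem_nhdsWithin] with s hs using sub_pos.2 (mem_Iio.1 hs)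
      exact (hflim.comp (tendsto_atTop_add_const_right _ (-1)
        (tendsto_inv_nhdsGT_zero.comp h0))).mono_left (inf_le_inf_right _ nhdsWithin_le_nhds)
  · simp only [ht.2, if_true]
    exact (c.acceptable _).ssubset.subset (hfmem _)

end FinitelyConnected

/-! ### Modulus estimates on dyadic annuli -/

section Modulus

/-- By disjointness at most one summand is nonzero at each point, so the power passes inside the
sum. -/
theorem lintegral_sum_indicator_rpow_le {X : Type*} [MeasurableSpace X]
    (μ : Measure X) {p : ℝ} (hp : 0 < p) (s : Finset ℕ)
    (c : ℕ → ℝ≥0∞) {A : ℕ → Set X} (hA : ∀ j, MeasurableSet (A j))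
    (hdisj : Pairwise (Function.onFun Disjoint A)) :
    ∫⁻ x, (∑ j ∈ s, c j * (A j).indicator 1 x) ^ p ∂μ ≤ ∑ j ∈ s, c j ^ p * μ (A j) := by
  have hpt : ∀ x, (∑ j ∈ s, c j * (A j).indicator 1 x) ^ p
      ≤ ∑ j ∈ s, (A j).indicator (fun _ => c j ^ p) x := by
    intro x
    by_cases hx : ∃ j ∈ s, x ∈ A j
    · obtain ⟨j, hj, hxj⟩ := hx
      rw [Finset.sum_eq_single_of_mem j hj fun i _ hij => by
        rw [indicator_of_notMem (disjoint_left.1 (hdisj hij.symm) hxj), mul_zero]]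
      refine le_trans (le_of_eq ?_) (Finset.single_le_sum (fun i _ => zero_le) hj)
      simp [hxj]
    · push Not at hx
      rw [Finset.sum_eq_zero fun j hj => by rw [indicator_of_notMem (hx j hj), mul_zero],
        ENNReal.zero_rpow_of_pos hp]
      exact zero_le
  refine (lintegral_mono hpt).trans (le_of_eq ?_)
  rw [lintegral_finsetSum _ fun j _ => measurable_const.indicator (hA j)]
  exact Finset.sum_congr rfl fun j _ => lintegral_indicator_const (hA j) _

theorem exists_measure_ball_le {X : Type*} [MetricSpace X] [MeasurableSpace X]
    {μ : Measure X}
    (hμ : ∀ (x : X) (r : ℝ), 0 < r → 0 < μ (ball x r) ∧ μ (ball x r) < ⊤) {x : X} {q : ℝ}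
    (hq : q ∈ dimensionSet μ x) :
    ∃ K R₀ : ℝ, 0 < K ∧ 0 < R₀ ∧ ∀ r, 0 < r → r ≤ R₀ →
      μ (ball x r) ≤ ENNReal.ofReal (K * r ^ q) := by
  obtain ⟨-, C, R₀, hC, hR₀, h⟩ := hq
  have hm : 0 < μ.real (ball x R₀) := ENNReal.toReal_pos (hμ x R₀ hR₀).1.ne' (hμ x R₀ hR₀).2.ne
  refine ⟨C * μ.real (ball x R₀) / R₀ ^ q, R₀, by positivity, hR₀, fun r hr hrR => ?_⟩
  have h1 := h r R₀ hr hrR le_rfl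
  rw [div_le_iff₀ hm, Real.div_rpow hr.le hR₀.le] at h1
  rw [← ofReal_measureReal (hμ x r hr).2.ne]
  refine ENNReal.ofReal_le_ofReal (h1.trans (le_of_eq ?_))
  ring

variable {X : Type*} [MetricSpace X] [MeasurableSpace X] [BorelSpace X]

theorem RectCurve.integral_sum_indicator (γ : RectCurve X) (s : Finset ℕ) (c : ℕ → ℝ≥0∞)
    {A : ℕ → Set X} (hA : ∀ j, MeasurableSet (A j)) :
    γ.integral (fun x => ∑ j ∈ s, c j * (A j).indicator 1 x)
      = ∑ j ∈ s, c j * γ.integral ((A j).indicator 1) := by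
  have hm : ∀ j, AEMeasurable (fun t => (A j).indicator (1 : X → ℝ≥0∞) (γ.toFun t))
      (volume.restrict (Icc 0 γ.length)) := fun j =>
    (measurable_one.indicator (hA j)).comp_aemeasurable γ.aemeasurable
  unfold RectCurve.integral
  rw [lintegral_finsetSum' _ fun j _ => (hm j).const_mul _]
  exact Finset.sum_congr rfl fun j _ => lintegral_const_mul'' _ (hm j)

/-- Upper bound for the modulus of curves crossing `N` dyadic annuli. -/
theorem modulus_le_sum_annuli (μ : Measure X) {p : ℝ} (hp : 0 < p) {x : X} {R : ℝ} (hR : 0 < R)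
    {N : ℕ} (hN : 0 < N) {Γ : Set (RectCurve X)}
    (hΓ : ∀ γ ∈ Γ, dist γ.source x ≤ R / 2 ^ N ∧ R ≤ dist γ.target x) :
    modulus μ p Γ ≤ ∑ j ∈ Finset.range N,
      ENNReal.ofReal (2 ^ (j + 1) / (R * N)) ^ p * μ (ball x (R / 2 ^ j)) := by
  let A : ℕ → Set X := fun j => ball x (R / 2 ^ j) \ ball x (R / 2 ^ (j + 1))
  have hA : ∀ j, MeasurableSet (A j) := fun j => measurableSet_ball.diff measurableSet_ball
  have hanti : ∀ i j : ℕ, i ≤ j → R / 2 ^ j ≤ R / 2 ^ i := fun i j hij => by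
    gcongr; exact one_le_two
  have hlt : ∀ i j, i < j → Disjoint (A i) (A j) := fun i j hij =>
    disjoint_left.2 fun y hyi hyj => hyi.2 (ball_subset_ball (hanti (i + 1) j hij) hyj.1)
  have hdisj : Pairwise (Function.onFun Disjoint A) := fun i j hij => by
    rcases lt_or_gt_of_ne hij with h | h
    · exact hlt i j h
    · exact (hlt j i h).symm
  -- The weight is `1 / N` divided by the width `R / 2 ^ (j + 1)` of the annulus, so each of the `N`
  -- crossings contributes at least `1 / N`.
  let c : ℕ → ℝ≥0∞ := fun j => ENNReal.ofReal (2 ^ (j + 1) / (R * N))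
  let ρ : X → ℝ≥0∞ := fun y => ∑ j ∈ Finset.range N, c j * (A j).indicator 1 y
  have hρ : Measurable ρ :=
    Finset.measurable_sum _ fun j _ => (measurable_one.indicator (hA j)).const_mul _
  have hadm : ∀ γ ∈ Γ, 1 ≤ γ.integral ρ := by
    intro γ hγ
    rw [γ.integral_sum_indicator _ c hA]
    have hlip : LipschitzOnWith 1 (fun t => dist (γ.toFun t) x) (Icc 0 γ.length) := by
      have := (LipschitzWith.dist_left x).comp_lipschitzOnWith γ.lipschitzOnWith
      simpa [Function.comp_def] using this
    obtain ⟨h1, h2⟩ := hΓ γ hγ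
    have hterm : ∀ j ∈ Finset.range N, (N : ℝ≥0∞)⁻¹ ≤ c j * γ.integral ((A j).indicator 1) := by
      intro j hj
      have hjN : j + 1 ≤ N := Finset.mem_range.1 hj
      have hvol := γ.volume_le_integral_indicator (A := A j)
        (S := Ico (R / 2 ^ (j + 1)) (R / 2 ^ j)) hlip (hA j) (fun s hs => by
          rw [uIcc_of_le (h1.trans ((hanti 0 N N.zero_le).trans (by simpa using h2)))]
          exact ⟨(h1.trans (hanti _ _ hjN)).trans hs.1,
            hs.2.le.trans ((hanti 0 j j.zero_le).trans (by simpa using h2))⟩)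
        (fun y hy => ⟨mem_ball.2 hy.2, fun h => (mem_ball.1 h).not_ge hy.1⟩)
      rw [Real.volume_Ico] at hvol
      calc (N : ℝ≥0∞)⁻¹ = c j * ENNReal.ofReal (R / 2 ^ j - R / 2 ^ (j + 1)) := by
            have hN' : (0 : ℝ) < N := by exact_mod_cast hN
            rw [← ENNReal.ofReal_mul (by positivity), ← ENNReal.ofReal_natCast,
              ← ENNReal.ofReal_inv_of_pos hN']
            congr 1
            field_simp
            ring
        _ ≤ _ := by gcongr
    calc (1 : ℝ≥0∞) = ∑ j ∈ Finset.range N, (N : ℝ≥0∞)⁻¹ := by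
          rw [Finset.sum_const, Finset.card_range, nsmul_eq_mul]
          exact (ENNReal.mul_inv_cancel (by exact_mod_cast hN.ne') (ENNReal.natCast_ne_top N)).symm
      _ ≤ _ := Finset.sum_le_sum hterm
  refine (iInf₂_le_of_le ρ ⟨hρ, hadm⟩
    (lintegral_sum_indicator_rpow_le μ hp _ c hA hdisj)).trans ?_
  exact Finset.sum_le_sum fun j _ => by gcongr; exact sdiff_subset

/-- If `p ∈ Q(x) ≠ (0, 1]`, then the curves joining small balls around `x` to the complement of a
fixed ball have small modulus. -/
theorem exists_modulus_le {μ : Measure X}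
    (hμ : ∀ (x : X) (r : ℝ), 0 < r → 0 < μ (ball x r) ∧ μ (ball x r) < ⊤) {p : ℝ} (hp : 1 ≤ p)
    {x : X} (hpx : p ∈ dimensionSet μ x) (hQ : dimensionSet μ x ≠ Ioc 0 1) {R : ℝ} (hR : 0 < R)
    {η : ℝ≥0∞} (hη : 0 < η) :
    ∃ r, 0 < r ∧ ∀ Γ : Set (RectCurve X),
      (∀ γ ∈ Γ, dist γ.source x ≤ r ∧ R ≤ dist γ.target x) → modulus μ p Γ ≤ η := by
  have hp0 : 0 < p := zero_lt_one.trans_le hp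
  rcases hp.eq_or_lt with rfl | hp1
  -- For `p = 1` spreading over many annuli gains nothing. But `1 ∈ Q(x)` gives `(0,1] ⊆ Q(x)`, so
  -- `Q(x) ≠ (0,1]` provides some `q > 1`, and a single annulus of outer radius `s` gives a bound of
  -- order `s ^ (q - 1)`.
  · have hex : ∃ q ∈ dimensionSet μ x, 1 < q := by
      by_contra hcon
      push Not at hcon
      refine hQ (Subset.antisymm (fun q hq => ⟨hq.1, hcon q hq⟩) fun q hq => ⟨hq.1, ?_⟩)
      obtain ⟨-, C, R₀, hC, hR₀, h⟩ := hpx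
      refine ⟨C, R₀, hC, hR₀, fun r s hr hrs hs => (h r s hr hrs hs).trans ?_⟩
      have hs0 : 0 < s := hr.trans_le hrs
      gcongr C * ?_
      exact Real.rpow_le_rpow_of_exponent_ge (by positivity) ((div_le_one hs0).2 hrs) hq.2
    obtain ⟨q, hq, hq1⟩ := hex
    obtain ⟨K, R₀, hK, hR₀, hball⟩ := exists_measure_ball_le hμ hq
    have hlim : Tendsto (fun s : ℝ => ENNReal.ofReal (2 * K * s ^ (q - 1))) (𝓝[>] 0) (𝓝 0) := by
      have h1 : Tendsto (fun s : ℝ => 2 * K * s ^ (q - 1)) (𝓝[>] 0) (𝓝 0) := by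
        have h2 : ContinuousAt (fun s : ℝ => s ^ (q - 1)) 0 :=
          Real.continuousAt_rpow_const _ _ (Or.inr (by linarith))
        have h3 := (h2.tendsto.mono_left (nhdsWithin_le_nhds (s := Ioi 0))).const_mul (2 * K)
        rwa [Real.zero_rpow (by linarith), mul_zero] at h3
      simpa using ENNReal.tendsto_ofReal h1
    obtain ⟨s, ⟨⟨hsη, hsR⟩, hsR₀⟩, hs0⟩ := (((hlim.eventually (ge_mem_nhds hη)).and
      (nhdsWithin_le_nhds (Iic_mem_nhds hR))).and
      (nhdsWithin_le_nhds (Iic_mem_nhds hR₀))).and self_mem_nhdsWithin |>.exists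
    have hs0 : 0 < s := hs0
    refine ⟨s / 2, by positivity, fun Γ hΓ => ?_⟩
    refine (modulus_le_sum_annuli μ hp0 hs0 one_pos fun γ hγ =>
      ⟨by simpa using (hΓ γ hγ).1, hsR.trans (hΓ γ hγ).2⟩).trans (le_trans ?_ hsη)
    simp only [Finset.range_one, Finset.sum_singleton, ENNReal.rpow_one]
    calc _ ≤ ENNReal.ofReal (2 ^ (0 + 1) / (s * (1 : ℕ))) * ENNReal.ofReal (K * s ^ q) := by
          gcongr
          simpa using hball s hs0 hsR₀
      _ = ENNReal.ofReal (2 * K * s ^ (q - 1)) := by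
          rw [← ENNReal.ofReal_mul (by positivity), Real.rpow_sub_one hs0.ne']
          congr 1
          push_cast
          ring
  -- For `p > 1` each of the `N` annuli contributes at most a constant times `N ^ (-p)`, so the sum
  -- is of order `N ^ (1 - p)`.
  · obtain ⟨K, R₀, hK, hR₀, hball⟩ := exists_measure_ball_le hμ hpx
    have hlim : Tendsto (fun N : ℕ => ENNReal.ofReal (2 ^ p * K * (N : ℝ) ^ (-(p - 1))))
        atTop (𝓝 0) := by
      have h1 := ((tendsto_rpow_neg_atTop (sub_pos.2 hp1)).comp
        tendsto_natCast_atTop_atTop).const_mul (2 ^ p * K)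
      rw [mul_zero] at h1
      simpa using ENNReal.tendsto_ofReal h1
    obtain ⟨N, hNη, hN⟩ := ((hlim.eventually (ge_mem_nhds hη)).and (eventually_gt_atTop 0)).exists
    have hN' : (0 : ℝ) < N := by exact_mod_cast hN
    set s := min R R₀ with hs
    have hs0 : 0 < s := lt_min hR hR₀
    refine ⟨s / 2 ^ N, by positivity, fun Γ hΓ => ?_⟩
    refine (modulus_le_sum_annuli μ hp0 hs0 hN fun γ hγ =>
      ⟨(hΓ γ hγ).1, (min_le_left _ _).trans (hΓ γ hγ).2⟩).trans (le_trans ?_ hNη)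
    have hterm : ∀ j ∈ Finset.range N,
        ENNReal.ofReal (2 ^ (j + 1) / (s * N)) ^ p * μ (ball x (s / 2 ^ j))
          ≤ ENNReal.ofReal (2 ^ p * K * (N : ℝ) ^ (-p)) := by
      intro j _
      have hj : 0 < s / 2 ^ j := by positivity
      have hle : s / 2 ^ j ≤ R₀ :=
        (div_le_self hs0.le (one_le_pow₀ one_le_two)).trans (min_le_right _ _)
      calc _ ≤ ENNReal.ofReal (2 ^ (j + 1) / (s * N)) ^ p * ENNReal.ofReal (K * (s / 2 ^ j) ^ p) := by
            gcongr
            exact hball _ hj hle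
        _ = ENNReal.ofReal (2 ^ p * K * (N : ℝ) ^ (-p)) := by
            rw [ENNReal.ofReal_rpow_of_pos (by positivity), ← ENNReal.ofReal_mul (by positivity)]
            congr 1
            have e : (2 : ℝ) ^ (j + 1) / (s * N) = 2 * (N : ℝ)⁻¹ * (s / 2 ^ j)⁻¹ := by
              field_simp
              ring
            rw [e, Real.mul_rpow (by positivity) (by positivity),
              Real.mul_rpow (by positivity) (by positivity), Real.inv_rpow hN'.le,
              Real.inv_rpow hj.le, Real.rpow_neg hN'.le]
            have := (Real.rpow_pos_of_pos hj p).ne'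
            field_simp
    refine (Finset.sum_le_sum hterm).trans (le_of_eq ?_)
    rw [Finset.sum_const, Finset.card_range, nsmul_eq_mul, ← ENNReal.ofReal_natCast,
      ← ENNReal.ofReal_mul hN'.le]
    congr 1
    rw [show -(p - 1) = -p + 1 by ring, Real.rpow_add_one hN'.ne']
    ring

/-- A chain with a one-point impression `{x}` such that `p ∈ Q(x) ≠ (0, 1]` is a `Mod_p`-chain. -/
theorem Chain.isMod_of_impression [ProperSpace X] {Ω : Set X} (hΩ : IsOpen Ω) {μ : Measure X}
    (hμ : ∀ (x : X) (r : ℝ), 0 < r → 0 < μ (ball x r) ∧ μ (ball x r) < ⊤) {p : ℝ} (hp : 1 ≤ p)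
    {x : X} (hx : x ∈ frontier Ω) (hpx : p ∈ dimensionSet μ x)
    (hQ : dimensionSet μ x ≠ Ioc 0 1) {c : Chain Ω} (hc : c.impression = {x}) :
    c.IsMod μ p := by
  intro K hK hKΩ
  have hxK : x ∈ Kᶜ := fun h => hx.2 (hΩ.interior_eq.symm ▸ hKΩ h)
  obtain ⟨R, hR, hRK⟩ := Metric.isOpen_iff.1 hK.isClosed.isOpen_compl x hxK
  rw [ENNReal.tendsto_nhds_zero]
  intro η hη
  obtain ⟨r, hr, hmod⟩ := exists_modulus_le hμ hp hpx hQ hR hη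
  obtain ⟨l, hl⟩ := c.exists_subset_ball hc hr
  filter_upwards [eventually_ge_atTop l] with k hk
  exact hmod _ fun γ hγ => ⟨(mem_ball.1 (hl (c.antitone hk hγ.2.1))).le,
    not_lt.1 fun h => hRK (mem_ball.2 h) hγ.2.2⟩

end Modulus

end PrimeEnds

theorem mainTheorem2 {X : Type*} [MetricSpace X] [CompleteSpace X] [MeasurableSpace X]
    [BorelSpace X] (μ : Measure X)
    (hμ : ∀ (x : X) (r : ℝ), 0 < r → 0 < μ (ball x r) ∧ μ (ball x r) < ⊤)
    (hdoubling : PrimeEnds.IsDoubling μ)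
    (p : ℝ) (hp : 1 ≤ p) (hPI : PrimeEnds.SupportsPoincare μ p)
    (Ω : Set X) (hΩopen : IsOpen Ω) (hΩconn : IsConnected Ω)
    (hΩbdd : Bornology.IsBounded Ω) (hΩX : Ω ≠ Set.univ)
    (hfin : PrimeEnds.FinitelyConnectedAtBoundary Ω) :
    (∀ e ∈ PrimeEnds.primeEndBoundary Ω, ∃ x, e.impression = {x}) ∧
    (∀ x ∈ frontier Ω,
      (∃ e ∈ PrimeEnds.primeEndBoundary Ω, e.impression = {x}) ∧ PrimeEnds.IsAccessible Ω x) ∧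
    ((∀ x ∈ frontier Ω,
        p ∈ PrimeEnds.dimensionSet μ x ∧ PrimeEnds.dimensionSet μ x ≠ Set.Ioc 0 1) →
      PrimeEnds.primeEndBoundary Ω = PrimeEnds.modPrimeEndBoundary μ p Ω) := by
  have : ProperSpace X := PrimeEnds.properSpace_of_isDoubling hμ hdoubling
  have : LocallyPathConnectedSpace X := hPI.locallyPathConnectedSpace hp hμ hdoubling
  -- Each end is divisible by one with singleton impression; primality makes the two equal.
  have hprime : ∀ e ∈ PrimeEnds.primeEndBoundary Ω, ∃ (c : PrimeEnds.Chain Ω) (x : X),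
      x ∈ frontier Ω ∧ c.impression = {x} ∧ c.toEnd = e := by
    rintro ⟨d⟩ hd
    obtain ⟨c, x, hx, hcx, hcd⟩ := hfin.exists_divides hΩopen d
    exact ⟨c, x, hx, hcx, hd c.toEnd hcd⟩
  refine ⟨fun e he => ?_, fun x hx => ?_, fun hQ => Set.Subset.antisymm (fun e he => ?_) ?_⟩
  · obtain ⟨c, x, -, hcx, rfl⟩ := hprime e he
    exact ⟨x, hcx⟩
  · have hne : NeBot (𝓝[Ω] x) := mem_closure_iff_nhdsWithin_neBot.1 hx.1
    have hle : (Ultrafilter.of (𝓝[Ω] x) : Filter X) ≤ 𝓝[Ω] x := Ultrafilter.of_le _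
    obtain ⟨c, hcx, -, hopen, hball⟩ := (hfin x hx).exists_chain hΩopen hx _
      (hle.trans nhdsWithin_le_nhds) (hle self_mem_nhdsWithin)
    exact ⟨⟨c.toEnd, PrimeEnds.Chain.isPrime_of_impression hcx, hcx⟩,
      PrimeEnds.Chain.isAccessible hx (fun k => (hopen k).isConnected_iff_isPathConnected.1
        (c.acceptable k).isConnected) hball⟩
  · obtain ⟨c, x, hx, hcx, rfl⟩ := hprime e he
    exact ⟨⟨c, rfl, c.isMod_of_impression hΩopen hμ hp hx (hQ x hx).1 (hQ x hx).2 hcx⟩,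
      fun f _ hf => he f hf⟩
  -- The dividing chain `c` is a `Mod_p`-chain, so minimality among `Mod_p`-ends already identifies
  -- the given end with the prime end of `c`.
  · rintro ⟨d⟩ hd
    obtain ⟨c, x, hx, hcx, hcd⟩ := hfin.exists_divides hΩopen d
    have heq := hd.2 c.toEnd
      ⟨c, rfl, c.isMod_of_impression hΩopen hμ hp hx (hQ x hx).1 (hQ x hx).2 hcx⟩ hcd
    rw [← heq]
    exact PrimeEnds.Chain.isPrime_of_impression hcx
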